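/- **Conventions.** An *infinite Galois category* is a pair $(\mathcal C,F)$ of a category $\mathcal C$ with small colimits and finite limits and a functor $F:\mathcal C\to(\mathrm{Sets})$ that is faithful, conservative, and commutes with small colimits and finite limits, such that every object of $\mathcal C$ is a disjoint union of connected objects and $\mathcal C$ is generated under colimits by a set of connected objects (an object is connected if it is not initial and each of its subobjects is initial or everything). Its fundamental group is $\pi_1(\mathcal C,F):=\mathrm{Aut}(F)$, with the topology induced by the compact-open topologies on the permutation groups of the discrete sets $F(X)$. The pair is *tame* if $\pi_1(\mathcal C,F)$ acts transitively on $F(X)$ for every connected $X$. For a topological group $G$, let $G\text{-}(\mathrm{Sets})$ be the category of discrete sets with continuous $G$-action. The *Noohi completion* $G^{\mathrm{Noohi}}$ is the topological group of automorphisms of the forgetful functor $G\text{-}(\mathrm{Sets})\to(\mathrm{Sets})$, and $G$ is a *Noohi group* if the natural map $G\to G^{\mathrm{Noohi}}$ is an isomorphism of topological groups; $\pi_1$ of a tame infinite Galois category is a Noohi group. The *Noohi coproduct* of $G$ and $G'$ is the fundamental group of the category of discrete sets with two independent continuous actions of $G$ and $G'$ (for Noohi groups this is the coproduct in the category of Noohi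 groups). The *Noohi quotient* of $G$ by relations $\{f_i=g_i\}_{i\in I}$ is $(G/N)^{\mathrm{Noohi}}$, where $N$ is the smallest normal subgroup containing all $f_i^{-1}g_i$. Let $s\ge 1$, and let $\psi_i:\pi''_i\to\pi$, $\phi_i:\pi''_i\to\pi'$ $(1\le i\le s)$ be continuous homomorphisms of Noohi groups. Let $\Phi$ be the discrete group with generators $u_{ij}$ $(1\le i,j\le s)$ and relations $u_{ii}=e$, $u_{ij}u_{jk}=u_{ik}$, and put $v_i:=u_{1i}$ (so $v_1=e$, and $\Phi$ is free on $v_2,\dots,v_s$). The *Noohi Van Kampen group* $\mathbf{VK}(\pi,\pi';\pi''_1,\dots,\pi''_s)_{(\psi_i),(\phi_i)}$ is the Noohi quotient of the Noohi coproduct of $\pi$ and (the Noohi coproduct of $\pi'$ and $\Phi$) by the relations $\psi_i(a)=v_i^{-1}\phi_i(a)v_i$, $a\in\pi''_i$, $1\le i\le s$. **Proposition.** Let $s\ge 1$ and let $(\mathcal C,F)$, $(\mathcal D,G)$, $(\mathcal E_1,H_1),\dots,(\mathcal E_s,H_s)$ be tame infinite Galois categories. For $1\le j\le s$ let $u_j:\mathcal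 C\to\mathcal E_j$ and $v_j:\mathcal D\to\mathcal E_j$ be functors, and let $\alpha_j:H_j\circ u_j\xrightarrow{\cong}F$ and $\beta_j:H_j\circ v_j\xrightarrow{\cong}G$ be isomorphisms of functors. Let $$\psi_j:\pi_1(\mathcal E_j,H_j)\to\pi_1(\mathcal C,H_j\circ u_j)\to\pi_1(\mathcal C,F),\qquad \phi_j:\pi_1(\mathcal E_j,H_j)\to\pi_1(\mathcal D,H_j\circ v_j)\to\pi_1(\mathcal D,G)$$ be the induced continuous homomorphisms, where the second arrows are conjugation by $\alpha_j$ and by $\beta_j$. Let $\mathcal C\times_{\mathcal E_1\times\dots\times\mathcal E_s}\mathcal D$ be the 2-fibre product: its objects are the triples $(X,Y,\lambda)$ with $X\in\mathcal C$, $Y\in\mathcal D$ and $\lambda:(u_j(X))_j\to(v_j(Y))_j$ an isomorphism in $\prod_j\mathcal E_j$, and its morphisms are the pairs of morphisms in $\mathcal C$ and $\mathcal D$ that are compatible with the isomorphisms. Let $F'(X,Y,\lambda):=F(X)$. Then $(\mathcal C\times_{\mathcal E_1\times\dots\times\mathcal E_s}\mathcal D,\,F')$ is a tame infinite Galois category,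 and its fundamental group is isomorphic, as a topological group, to $$\mathbf{VK}\bigl(\pi_1(\mathcal C,F),\pi_1(\mathcal D,G);\pi_1(\mathcal E_1,H_1),\dots,\pi_1(\mathcal E_s,H_s)\bigr)_{(\psi_1,\dots,\psi_s),(\phi_1,\dots,\phi_s)}.$$ -/

import Mathlib

open CategoryTheory CategoryTheory.Limits

universe w v₁ v₂ v₃ u₁ u₂ u₃ a b c

/-! ### Fundamental groups and infinite Galois categories

Throughout, "sets" are the types in a fixed universe `Type w`. -/

namespace InfGalois

section Topology

variable {C : Type u₁} [Category.{v₁} C] (F : C ⥤ Type w)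

/-- The fundamental group `π₁(C, F)`: the automorphism group of the functor `F`. The product `σ * τ`
is "first `τ`, then `σ`", so it acts on every `F.obj X` from the left. -/
abbrev Pi1 := Aut F

/-- The topology on `Aut F` induced by the compact-open topology on the permutation groups of the
discrete sets `F.obj X`. Compact subsets of a discrete set are the finite ones, so this is the
coarsest topology for which every evaluation `σ ↦ σ x`, `x ∈ F.obj X`, is continuous into the
discrete set `F.obj X`. -/
instance : TopologicalSpace (Aut F) :=
  ⨅ (X : C) (x : F.obj X),
    TopologicalSpace.induced (Y := F.obj X) (fun σ : Aut F => σ.hom.app X x) ⊥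

variable {F}

theorem isOpen_setOf_app_eq (X : C) (x y : F.obj X) :
    IsOpen {σ : Aut F | σ.hom.app X x = y} := by
  let t : TopologicalSpace (F.obj X) := ⊥
  have ht : DiscreteTopology (F.obj X) := ⟨rfl⟩
  have h : (inferInstance : TopologicalSpace (Aut F)) ≤
      TopologicalSpace.induced (Y := F.obj X) (fun σ : Aut F => σ.hom.app X x) t :=
    (iInf_le _ X).trans (iInf_le _ x)
  exact h _ (isOpen_induced_iff.2 ⟨{y}, isOpen_discrete _, rfl⟩)

/-- A map into `Aut F` is continuous if (and only if) all sets `{t | f t x = y}` are open. -/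
theorem continuous_of_isOpen {T : Type*} [TopologicalSpace T] {f : T → Aut F}
    (h : ∀ (X : C) (x y : F.obj X), IsOpen {t | (f t).hom.app X x = y}) : Continuous f := by
  refine continuous_iInf_rng.2 fun X => continuous_iInf_rng.2 fun x => continuous_induced_rng.2 ?_
  let _ : TopologicalSpace (F.obj X) := ⊥
  have : DiscreteTopology (F.obj X) := ⟨rfl⟩
  exact continuous_discrete_rng.2 fun y => h X x y

/-- The fundamental group is a topological group. -/
instance : IsTopologicalGroup (Aut F) where
  continuous_mul := by
    refine continuous_of_isOpen fun X x y => ?_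
    have : {t : Aut F × Aut F | (t.1 * t.2).hom.app X x = y} =
        ⋃ z, {σ : Aut F | σ.hom.app X z = y} ×ˢ {τ : Aut F | τ.hom.app X x = z} := by
      ext t
      change t.1.hom.app X (t.2.hom.app X x) = y ↔ _
      simp
    rw [this]
    exact isOpen_iUnion fun z => (isOpen_setOf_app_eq X z y).prod (isOpen_setOf_app_eq X x z)
  continuous_inv := by
    refine continuous_of_isOpen fun X x y => ?_
    have : {t : Aut F | (t⁻¹).hom.app X x = y} = {σ : Aut F | σ.hom.app X y = x} := by
      ext t
      change t.inv.app X x = y ↔ t.hom.app X y = x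
      constructor
      · rintro rfl
        exact Iso.inv_hom_id_app_apply t X x
      · rintro rfl
        exact Iso.hom_inv_id_app_apply t X y
    rw [this]
    exact isOpen_setOf_app_eq X y x

end Topology

/-- `(C, F)` is an infinite Galois category. An object is connected
(`PreGaloisCategory.IsConnected`) if it is not initial and each of its subobjects is initial or
everything. -/
structure IsInfiniteGalois {C : Type u₁} [Category.{v₁} C] (F : C ⥤ Type w) : Prop where
  /-- `C` has all small colimits. -/
  hasColimits : HasColimitsOfSize.{w, w} C
  /-- `C` has finite limits. -/
  hasFiniteLimits : HasFiniteLimits C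
  /-- Every object is a disjoint union of connected objects. -/
  exists_connected_components : ∀ X : C, ∃ (ι : Type w) (Y : ι → C) (f : ∀ i, Y i ⟶ X),
    (∀ i, PreGaloisCategory.IsConnected (Y i)) ∧ Nonempty (IsColimit (Cofan.mk X f))
  /-- `C` is generated under small colimits by a small set of connected objects. -/
  exists_generators : ∃ (ι : Type w) (Y : ι → C), (∀ i, PreGaloisCategory.IsConnected (Y i)) ∧
    ∀ X : C, (ObjectProperty.ofObj Y).colimitsClosure (fun J : Cat.{w, w} => (J : Type w)) X
  faithful : F.Faithful
  /-- `F` is conservative. -/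
  reflectsIsomorphisms : F.ReflectsIsomorphisms
  preservesColimits : PreservesColimitsOfSize.{w, w} F
  preservesFiniteLimits : PreservesFiniteLimits F

/-- `(C, F)` is a tame infinite Galois category: `π₁(C, F)` acts transitively on `F(X)` for every
connected object `X`. -/
structure IsTameInfiniteGalois {C : Type u₁} [Category.{v₁} C] (F : C ⥤ Type w) : Prop
    extends IsInfiniteGalois F where
  transitive : ∀ X : C, PreGaloisCategory.IsConnected X →
    ∀ x y : F.obj X, ∃ σ : Pi1 F, σ.hom.app X x = y

/-- The continuous homomorphism `π₁(E, H) → π₁(C, H ∘ u) → π₁(C, F)` attached to a functor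
`u : C ⥤ E` and an isomorphism `α : H ∘ u ≅ F`: whisker with `u`, then conjugate by `α`. -/
def pi1Map {C : Type u₁} [Category.{v₁} C] {E : Type u₃} [Category.{v₃} E]
    {F : C ⥤ Type w} {H : E ⥤ Type w} (u : C ⥤ E) (α : u ⋙ H ≅ F) : Pi1 H →ₜ* Pi1 F where
  toMonoidHom := α.conjAut.toMonoidHom.comp (((Functor.whiskeringLeft C E (Type w)).obj u).mapAut H)
  continuous_toFun := by
    refine continuous_of_isOpen fun X x y => ?_
    convert isOpen_setOf_app_eq (F := H) (u.obj X) (α.inv.app X x) (α.inv.app X y) using 1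
    ext σ
    change α.hom.app X (σ.hom.app (u.obj X) (α.inv.app X x)) = y ↔
      σ.hom.app (u.obj X) (α.inv.app X x) = α.inv.app X y
    constructor
    · intro h
      rw [← h]
      exact (Iso.hom_inv_id_app_apply α X _).symm
    · intro h
      rw [h]
      exact Iso.inv_hom_id_app_apply α X y

/-! ### Noohi completion, coproduct and quotient -/

section GSet

variable (G : Type a) [Group G] [TopologicalSpace G]

/-- Discrete sets with a continuous action of the topological group `G`. -/
structure GSet where
  carrier : Type w
  ρ : G →* Equiv.Perm carrier
  /-- The action `G × carrier → carrier` is continuous for the discrete topology on `carrier`. -/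
  isOpen_setOf_eq : ∀ x y : carrier, IsOpen {g : G | ρ g x = y}

/-- Morphisms of `G`-sets: equivariant maps. -/
@[ext]
structure GSet.Hom (S T : GSet.{w} G) where
  toFun : S.carrier → T.carrier
  map_smul : ∀ (g : G) (x : S.carrier), toFun (S.ρ g x) = T.ρ g (toFun x)

instance : Category (GSet.{w} G) where
  Hom := GSet.Hom G
  id S := ⟨fun x => x, fun _ _ => rfl⟩
  comp f g := ⟨fun x => g.toFun (f.toFun x), fun r x => by rw [f.map_smul, g.map_smul]⟩

/-- The forgetful functor from `G`-sets to sets. -/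
def GSet.forget : GSet.{w} G ⥤ Type w where
  obj S := S.carrier
  map f := ↾(GSet.Hom.toFun f)

/-- The Noohi completion `G^Noohi` of a topological group: the automorphism group of the forgetful
functor from `G`-sets to sets. -/
abbrev NoohiCompletion := Pi1 (GSet.forget.{w} G)

/-- The Noohi quotient of `G` by a subgroup `H`: the Noohi completion of the quotient of `G` by the
smallest normal subgroup containing `H`. -/
abbrev NoohiQuotient (H : Subgroup G) :=
  NoohiCompletion.{w} (G ⧸ Subgroup.normalClosure (H : Set G))

/-- The Noohi quotient of `G` by the relations `f i = g i`. -/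
abbrev NoohiQuotientRel {ι : Type b} (f g : ι → G) :=
  NoohiQuotient.{w} G (Subgroup.closure (Set.range fun i => (f i)⁻¹ * g i))

end GSet

section Coprod

variable (G : Type a) [Group G] [TopologicalSpace G] (H : Type b) [Group H] [TopologicalSpace H]

/-- Discrete sets with two independent continuous actions, of `G` and of `H`. -/
structure TwoSet where
  carrier : Type w
  ρ₁ : G →* Equiv.Perm carrier
  ρ₂ : H →* Equiv.Perm carrier
  isOpen_setOf_eq₁ : ∀ x y : carrier, IsOpen {g : G | ρ₁ g x = y}
  isOpen_setOf_eq₂ : ∀ x y : carrier, IsOpen {h : H | ρ₂ h x = y}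

/-- Morphisms: maps equivariant for both actions. -/
@[ext]
structure TwoSet.Hom (S T : TwoSet.{w} G H) where
  toFun : S.carrier → T.carrier
  map_smul₁ : ∀ (g : G) (x : S.carrier), toFun (S.ρ₁ g x) = T.ρ₁ g (toFun x)
  map_smul₂ : ∀ (h : H) (x : S.carrier), toFun (S.ρ₂ h x) = T.ρ₂ h (toFun x)

instance : Category (TwoSet.{w} G H) where
  Hom := TwoSet.Hom G H
  id S := ⟨fun x => x, fun _ _ => rfl, fun _ _ => rfl⟩
  comp f g := ⟨fun x => g.toFun (f.toFun x),
    fun r x => by rw [f.map_smul₁, g.map_smul₁], fun r x => by rw [f.map_smul₂, g.map_smul₂]⟩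

/-- The forgetful functor to sets. -/
def TwoSet.forget : TwoSet.{w} G H ⥤ Type w where
  obj S := S.carrier
  map f := ↾(TwoSet.Hom.toFun f)

/-- The Noohi coproduct of `G` and `H` (their coproduct in the category of Noohi groups): the
fundamental group of the category of discrete sets with two independent continuous actions, of `G`
and of `H`. -/
abbrev NoohiCoprod := Pi1 (TwoSet.forget.{w} G H)

namespace NoohiCoprod

variable {G H}

/-- The canonical continuous homomorphism from `G` to the Noohi coproduct: `g` acts on a set with
two actions through the first one. -/
def inl : G →ₜ* NoohiCoprod.{w} G H where
  toFun g := NatIso.ofComponents (fun S => (S.ρ₁ g).toIso) (by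
    intro S T f
    ext x
    exact (TwoSet.Hom.map_smul₁ f g x).symm)
  map_one' := by
    ext S x
    change S.ρ₁ 1 x = x
    rw [map_one]; rfl
  map_mul' g g' := by
    ext S x
    change S.ρ₁ (g * g') x = S.ρ₁ g (S.ρ₁ g' x)
    rw [map_mul]; rfl
  continuous_toFun := continuous_of_isOpen fun S x y => S.isOpen_setOf_eq₁ x y

/-- The canonical continuous homomorphism from `H` to the Noohi coproduct. -/
def inr : H →ₜ* NoohiCoprod.{w} G H where
  toFun g := NatIso.ofComponents (fun S => (S.ρ₂ g).toIso) (by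
    intro S T f
    ext x
    exact (TwoSet.Hom.map_smul₂ f g x).symm)
  map_one' := by
    ext S x
    change S.ρ₂ 1 x = x
    rw [map_one]; rfl
  map_mul' g g' := by
    ext S x
    change S.ρ₂ (g * g') x = S.ρ₂ g (S.ρ₂ g' x)
    rw [map_mul]; rfl
  continuous_toFun := continuous_of_isOpen fun S x y => S.isOpen_setOf_eq₂ x y

end NoohiCoprod

end Coprod

/-! ### The Noohi Van Kampen group -/

/-- The relations `u i i = e` and `u i j * u j k = u i k`. -/
def edgeRels (s : ℕ) : Set (FreeGroup (Fin s × Fin s)) :=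
  {r | ∃ i, r = FreeGroup.of (i, i)} ∪
    {r | ∃ i j k, r = FreeGroup.of (i, j) * FreeGroup.of (j, k) * (FreeGroup.of (i, k))⁻¹}

/-- The group with generators `u i j` and relations `u i i = e`, `u i j * u j k = u i k`. -/
def EdgeGroup (s : ℕ) : Type := PresentedGroup (edgeRels s)

instance (s : ℕ) : Group (EdgeGroup s) := inferInstanceAs (Group (PresentedGroup (edgeRels s)))

/-- The group of edges is discrete. -/
instance (s : ℕ) : TopologicalSpace (EdgeGroup s) := ⊥

/-- The generator `u i j`. -/
def EdgeGroup.u {s : ℕ} (i j : Fin s) : EdgeGroup s := PresentedGroup.of (rels := edgeRels s) (i, j)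

/-- The generator `v i = u 0 i`, where `0` is the first index; in particular `v 0 = e`. -/
def EdgeGroup.v {s : ℕ} [NeZero s] (i : Fin s) : EdgeGroup s := EdgeGroup.u 0 i

section VK

variable {s : ℕ} [NeZero s] {P : Type a} [Group P] [TopologicalSpace P]
  {P' : Type b} [Group P'] [TopologicalSpace P']
  {P'' : Fin s → Type c} [∀ i, Group (P'' i)] [∀ i, TopologicalSpace (P'' i)]

variable (P P' s) in
/-- The Noohi coproduct of `P` and of the Noohi coproduct of `P'` with the discrete group of
edges. -/
abbrev VKCoprod := NoohiCoprod.{w} P (NoohiCoprod.{w} P' (EdgeGroup s))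

/-- The Noohi Van Kampen group `VK(P, P'; P''₁, …, P''ₛ)` of the homomorphisms `ψ i : P'' i → P` and
`φ i : P'' i → P'`: the Noohi quotient of the Noohi coproduct of `P`, `P'` and the group of edges by
the relations `ψ i x = (v i)⁻¹ * φ i x * v i`, for `i : Fin s` and `x : P'' i`. -/
abbrev VK (ψ : ∀ i, P'' i →ₜ* P) (φ : ∀ i, P'' i →ₜ* P') :=
  NoohiQuotientRel.{w} (VKCoprod.{w} s P P') (ι := Σ i, P'' i)
    (fun p => NoohiCoprod.inl (ψ p.1 p.2))
    (fun p => NoohiCoprod.inr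
      ((NoohiCoprod.inr (EdgeGroup.v p.1))⁻¹ * NoohiCoprod.inl (φ p.1 p.2) *
        NoohiCoprod.inr (EdgeGroup.v p.1)))

end VK

end InfGalois

/-! A tame infinite Galois category is equivalent, through its fibre functor, to the category of
discrete sets with a continuous action of its fundamental group (`full_fiberFunctor`,
`essSurj_fiberFunctor`; faithfulness is part of the definition). Hence an object of the fibre
product amounts to a `π₁(C)`-set `S`, a `π₁(D)`-set `T` and bijections `b j : S ≃ T` that intertwine
the actions of `π₁(E j)` through `ψ j` and `φ j`.

Use `b 0` to move the action on `T` to `S`. The other bijections survive as the permutations `(b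
0)⁻¹ ∘ b j` of `S`, which are arbitrary and trivial for `j = 0`: they are an action of the edge
group in which `v j` acts by `(b 0)⁻¹ ∘ b j`. That `b j` intertwines `ψ j` and `φ j` is then the
relation `ψ j a = (v j)⁻¹ * φ j a * v j`. So the data are a continuous action on `S` of the quotient
`VKQuotient` of the Noohi coproduct by these relations, and the fibre product is equivalent to
`VKQuotient`-sets, compatibly with the fibre functors. By definition the fundamental group of
`VKQuotient`-sets is the Noohi completion of `VKQuotient`, that is, `VK`.

Two points need care. A set with two actions carries a tautological action of the Noohi coproduct,
but equivariance must be descended to the two factors; this works because they generate a dense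
subgroup (`NoohiCoprod.dense_closure`) and the sets are discrete. And the sets with an action of a
topological group form a tame infinite Galois category once the group is small, since there must be
a small set of generators. Fundamental groups are small because generators determine automorphisms;
the Noohi coproduct is small because it is Hausdorff with a small dense subgroup. -/

namespace InfGalois

/-- A family of self-maps that is multiplicative in a group acts by permutations. -/
def permHom {G : Type*} [Group G] {X : Type*} (f : G → X → X) (h_one : ∀ x, f 1 x = x)
    (h_mul : ∀ g h x, f (g * h) x = f g (f h x)) : G →* Equiv.Perm X :=
  MonoidHom.toHomPerm
    { toFun := f
      map_one' := funext h_one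
      map_mul' g h := funext (h_mul g h) }

@[simp]
theorem permHom_apply {G : Type*} [Group G] {X : Type*} (f : G → X → X) (h_one : ∀ x, f 1 x = x)
    (h_mul : ∀ g h x, f (g * h) x = f g (f h x)) (g : G) (x : X) :
    permHom f h_one h_mul g x = f g x := rfl

/-! ### Discrete sets with a continuous action form a tame infinite Galois category -/

namespace GSet

variable {Q : Type a} [Group Q] [TopologicalSpace Q]

/-- The underlying action of the abstract group. -/
def toAction : GSet.{w} Q ⥤ Action (Type w) Q where
  obj S :=
    { V := S.carrier
      ρ :=
        { toFun g := ↾(S.ρ g)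
          map_one' := by rw [map_one]; rfl
          map_mul' g h := by rw [map_mul]; rfl } }
  map f :=
    { hom := ↾(GSet.Hom.toFun f)
      comm g := by
        ext x
        exact GSet.Hom.map_smul f g x }

instance : (toAction (Q := Q)).Faithful where
  map_injective {_ _ f g} h := by
    refine GSet.Hom.ext (funext fun x => ?_)
    exact ConcreteCategory.congr_hom (congrArg Action.Hom.hom h) x

instance : (toAction (Q := Q)).Full where
  map_surjective f :=
    ⟨⟨f.hom, fun g x => ConcreteCategory.congr_hom (f.comm g) x⟩, rfl⟩

/-- An action of the abstract group all of whose orbit maps are locally constant. -/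
def ofAction (A : Action (Type w) Q) (h : ∀ x y : A.V, IsOpen {g : Q | A.ρ g x = y}) :
    GSet.{w} Q where
  carrier := A.V
  ρ := permHom (fun g x => A.ρ g x) (fun x => by rw [map_one]; rfl)
    (fun g h x => by rw [map_mul]; rfl)
  isOpen_setOf_eq := h

/-- An action with continuous orbit maps comes from a `GSet`. -/
def toActionOfActionIso (A : Action (Type w) Q) (h : ∀ x y : A.V, IsOpen {g : Q | A.ρ g x = y}) :
    toAction.obj (ofAction A h) ≅ A := Iso.refl _

/-- Each point of the colimit is the image of a point `x` of some `K.obj j`, and elements of the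
group that agree on `x` agree on its image, so orbit maps stay locally constant. -/
noncomputable instance {J : Type*} [Category* J] [HasColimitsOfShape J (Type w)] :
    CreatesColimitsOfShape J (toAction.{w} (Q := Q)) where
  CreatesColimit {K} := by
    refine createsColimitOfFullyFaithfulOfIso
      (ofAction (colimit (K ⋙ toAction)) fun x y => ?_) (toActionOfActionIso _ _)
    obtain ⟨j, x, rfl⟩ := Types.jointly_surjective_of_isColimit
      (isColimitOfPreserves (Action.forget _ _) (colimit.isColimit (K ⋙ toAction))) x
    have key (g : Q) : (colimit (K ⋙ toAction)).ρ g ((colimit.ι (K ⋙ toAction) j).hom x) =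
        (colimit.ι (K ⋙ toAction) j).hom ((K.obj j).ρ g x) :=
      (ConcreteCategory.congr_hom ((colimit.ι (K ⋙ toAction) j).comm g) x).symm
    refine isOpen_iff_forall_mem_open.2 fun g₀ hg₀ =>
      ⟨_, ?_, (K.obj j).isOpen_setOf_eq x ((K.obj j).ρ g₀ x), rfl⟩
    intro g hg
    refine Eq.trans ?_ hg₀
    exact (key g).trans ((congrArg _ hg).trans (key g₀).symm)

/-- A point of the limit is given by finitely many coordinates, so the condition `g x = y` is a
finite intersection of open ones. -/
noncomputable instance {J : Type} [SmallCategory J] [FinCategory J] :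
    CreatesLimitsOfShape J (toAction.{w} (Q := Q)) where
  CreatesLimit {K} := by
    refine createsLimitOfFullyFaithfulOfIso
      (ofAction (limit (K ⋙ toAction)) fun x y => ?_) (toActionOfActionIso _ _)
    have key (g : Q) (j : J) (x) : (limit.π (K ⋙ toAction) j).hom ((limit (K ⋙ toAction)).ρ g x) =
        (K.obj j).ρ g ((limit.π (K ⋙ toAction) j).hom x) :=
      ConcreteCategory.congr_hom ((limit.π (K ⋙ toAction) j).comm g) x
    have : {g : Q | (limit (K ⋙ toAction)).ρ g x = y} =
        ⋂ j, {g : Q | (K.obj j).ρ g ((limit.π (K ⋙ toAction) j).hom x) =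
          (limit.π (K ⋙ toAction) j).hom y} := by
      ext g
      simp only [Set.mem_ofPred_eq, Set.mem_iInter]
      constructor
      · rintro rfl j
        exact (key g j x).symm
      · intro h
        refine Concrete.isLimit_ext _ (isLimitOfPreserves (Action.forget _ _)
          (limit.isLimit (K ⋙ toAction))) _ _ fun j => ?_
        exact (key g j x).trans (h j)
    rw [this]
    exact isOpen_iInter_of_finite fun j => (K.obj j).isOpen_setOf_eq _ _

instance : HasColimitsOfSize.{w, w} (GSet.{w} Q) where
  has_colimits_of_shape _ _ := hasColimitsOfShape_of_hasColimitsOfShape_createsColimitsOfShape toAction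

instance : HasFiniteLimits (GSet.{w} Q) where
  out _ _ _ := hasLimitsOfShape_of_hasLimitsOfShape_createsLimitsOfShape toAction

instance : PreservesColimitsOfSize.{w, w} (GSet.forget.{w} Q) where
  preservesColimitsOfShape {J} _ :=
    inferInstanceAs (PreservesColimitsOfShape J (toAction.{w} (Q := Q) ⋙ Action.forget _ _))

instance : PreservesFiniteLimits (GSet.forget.{w} Q) where
  preservesFiniteLimits J _ _ :=
    inferInstanceAs (PreservesLimitsOfShape J (toAction.{w} (Q := Q) ⋙ Action.forget _ _))

instance : (GSet.forget.{w} Q).Faithful :=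
  inferInstanceAs (toAction.{w} (Q := Q) ⋙ Action.forget _ _).Faithful

/-- Isomorphisms of `G`-sets are the equivariant bijections. -/
noncomputable def isoOfBijective {S T : GSet.{w} Q} (f : S ⟶ T)
    (hf : Function.Bijective (GSet.Hom.toFun f)) : S ≅ T where
  hom := f
  inv := ⟨(Equiv.ofBijective _ hf).symm, fun g x => by
    apply hf.injective
    rw [GSet.Hom.map_smul f]
    simp only [Equiv.ofBijective_apply_symm_apply]⟩
  hom_inv_id := GSet.Hom.ext (funext (Equiv.ofBijective _ hf).symm_apply_apply)
  inv_hom_id := GSet.Hom.ext (funext (Equiv.ofBijective _ hf).apply_symm_apply)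

theorem isIso_of_bijective {S T : GSet.{w} Q} (f : S ⟶ T)
    (hf : Function.Bijective (GSet.Hom.toFun f)) : IsIso f :=
  (isoOfBijective f hf).isIso_hom

theorem bijective_of_isIso {S T : GSet.{w} Q} (f : S ⟶ T) [IsIso f] :
    Function.Bijective (GSet.Hom.toFun f) :=
  (isIso_iff_bijective ((GSet.forget Q).map f)).1 inferInstance

instance : (GSet.forget.{w} Q).ReflectsIsomorphisms where
  reflects f _ := isIso_of_bijective f ((isIso_iff_bijective ((GSet.forget Q).map f)).1 ‹_›)

/-- The restriction of the action to a stable subset. -/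
def restrict (S : GSet.{w} Q) (A : Set S.carrier) (hA : ∀ (g : Q), ∀ x ∈ A, S.ρ g x ∈ A) :
    GSet.{w} Q where
  carrier := A
  ρ := permHom (fun g x => ⟨S.ρ g x, hA g x x.2⟩) (by simp) (by simp)
  isOpen_setOf_eq x y := by
    convert S.isOpen_setOf_eq x y using 3
    exact Subtype.ext_iff

/-- The inclusion of a stable subset. -/
def restrictι (S : GSet.{w} Q) (A : Set S.carrier) (hA : ∀ (g : Q), ∀ x ∈ A, S.ρ g x ∈ A) :
    S.restrict A hA ⟶ S := ⟨Subtype.val, fun _ _ => rfl⟩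

/-- The map from a transitive `G`-set given by the image of one point. -/
theorem exists_hom_of_stabilizer_le {S T : GSet.{w} Q} (s : S.carrier) (t : T.carrier)
    (hs : ∀ x, ∃ g, S.ρ g s = x) (h : ∀ g, S.ρ g s = s → T.ρ g t = t) :
    ∃ f : S ⟶ T, GSet.Hom.toFun f s = t := by
  have key (g g' : Q) (e : S.ρ g s = S.ρ g' s) : T.ρ g t = T.ρ g' t := by
    have : T.ρ (g'⁻¹ * g) t = t := h _ (by
      rw [map_mul, map_inv, Equiv.Perm.mul_apply, e, Equiv.Perm.inv_eq_iff_eq])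
    rw [map_mul, map_inv, Equiv.Perm.mul_apply, Equiv.Perm.inv_eq_iff_eq] at this
    exact this
  choose r hr using hs
  refine ⟨⟨fun x => T.ρ (r x) t, fun g x => ?_⟩, ?_⟩
  · rw [← Equiv.Perm.mul_apply, ← map_mul]
    apply key
    rw [hr, map_mul, Equiv.Perm.mul_apply, hr]
  · refine (key _ 1 ?_).trans (by simp)
    simp [hr]

theorem isEmpty_of_isInitial {S : GSet.{w} Q} (h : IsInitial S) : IsEmpty S.carrier :=
  (Types.initial_iff_empty _).1 ⟨h.isInitialObj (GSet.forget Q)⟩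

/-- An empty `G`-set is initial. -/
def isInitialOfIsEmpty (S : GSet.{w} Q) [IsEmpty S.carrier] : IsInitial S :=
  IsInitial.ofUniqueHom (fun _ => ⟨isEmptyElim, fun _ => isEmptyElim⟩)
    fun _ _ => GSet.Hom.ext (funext isEmptyElim)

theorem isConnected_of_transitive (S : GSet.{w} Q) (s : S.carrier)
    (hs : ∀ x, ∃ g, S.ρ g s = x) : PreGaloisCategory.IsConnected S where
  notInitial h := (isEmpty_of_isInitial h).false s
  noTrivialComponent T i _ hT := by
    have : Nonempty T.carrier := by
      by_contra h
      rw [not_nonempty_iff] at h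
      exact hT (isInitialOfIsEmpty T)
    obtain ⟨t⟩ := this
    have hi : Function.Injective (GSet.Hom.toFun i) :=
      (mono_iff_injective ((GSet.forget Q).map i)).1 inferInstance
    refine isIso_of_bijective i ⟨hi, fun x => ?_⟩
    obtain ⟨g, hg⟩ := hs x
    obtain ⟨g', hg'⟩ := hs (GSet.Hom.toFun i t)
    refine ⟨T.ρ (g * g'⁻¹) t, ?_⟩
    rw [GSet.Hom.map_smul i, map_mul, map_inv, Equiv.Perm.mul_apply,
      Equiv.Perm.inv_eq_iff_eq.2 hg'.symm, hg]

/-- The orbit of `x` is a non-empty subobject, hence everything. -/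
theorem transitive_of_isConnected (S : GSet.{w} Q) (h : PreGaloisCategory.IsConnected S)
    (x y : S.carrier) : ∃ g, S.ρ g x = y := by
  let A : Set S.carrier := {z | ∃ g, S.ρ g x = z}
  have hA : ∀ (g : Q), ∀ x ∈ A, S.ρ g x ∈ A := by
    rintro g _ ⟨g', rfl⟩
    exact ⟨g * g', by simp⟩
  have : Mono (S.restrictι A hA) := (GSet.forget Q).mono_of_mono_map
    ((mono_iff_injective _).2 Subtype.val_injective)
  have hx : x ∈ A := ⟨1, by simp⟩
  have := h.noTrivialComponent _ (S.restrictι A hA) fun hi =>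
    (isEmpty_of_isInitial hi).false ⟨x, hx⟩
  obtain ⟨z, rfl⟩ := (bijective_of_isIso (S.restrictι A hA)).2 y
  exact z.2

/-- The orbit relation. -/
def orbitSetoid (S : GSet.{w} Q) : Setoid S.carrier where
  r x y := ∃ g, S.ρ g x = y
  iseqv :=
    { refl x := ⟨1, by simp⟩
      symm := by
        rintro x _ ⟨g, rfl⟩
        exact ⟨g⁻¹, by simp⟩
      trans := by
        rintro x _ _ ⟨g, rfl⟩ ⟨g', rfl⟩
        exact ⟨g' * g, by simp⟩ }

theorem mk_smul (S : GSet.{w} Q) (g : Q) (x : S.carrier) :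
    (Quotient.mk S.orbitSetoid (S.ρ g x)) = Quotient.mk S.orbitSetoid x :=
  (Quotient.sound (s := S.orbitSetoid) ⟨g, rfl⟩ : Quotient.mk S.orbitSetoid x = _).symm

/-- The orbits as `G`-sets. -/
def orbit (S : GSet.{w} Q) (i : Quotient S.orbitSetoid) : GSet.{w} Q :=
  S.restrict {x | Quotient.mk S.orbitSetoid x = i} (by
    rintro g x rfl
    exact S.mk_smul g x)

/-- The inclusion of an orbit. -/
def orbitι (S : GSet.{w} Q) (i : Quotient S.orbitSetoid) : S.orbit i ⟶ S := S.restrictι _ _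

theorem orbit_transitive (S : GSet.{w} Q) (i : Quotient S.orbitSetoid) (x y : (S.orbit i).carrier) :
    ∃ g, (S.orbit i).ρ g x = y := by
  obtain ⟨g, hg⟩ := Quotient.exact (x.2.trans y.2.symm)
  exact ⟨g, Subtype.ext hg⟩

theorem orbit_nonempty (S : GSet.{w} Q) (i : Quotient S.orbitSetoid) :
    Nonempty (S.orbit i).carrier := by
  obtain ⟨x, rfl⟩ := Quotient.exists_rep i
  exact ⟨⟨x, rfl⟩⟩

theorem orbit_isConnected (S : GSet.{w} Q) (i : Quotient S.orbitSetoid) :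
    PreGaloisCategory.IsConnected (S.orbit i) :=
  isConnected_of_transitive _ _ (S.orbit_transitive i (S.orbit_nonempty i).some)

/-- A `G`-set is the disjoint union of its orbits. -/
def isColimitOrbits (S : GSet.{w} Q) : IsColimit (Cofan.mk S S.orbitι) := by
  have key (t : Cofan S.orbit) (i) (x : S.carrier) (h : Quotient.mk S.orbitSetoid x = i) :
      GSet.Hom.toFun (t.inj i) ⟨x, h⟩ =
        GSet.Hom.toFun (t.inj (Quotient.mk S.orbitSetoid x)) ⟨x, rfl⟩ := by
    subst h; rfl
  refine Cofan.IsColimit.mk _ (fun t => ⟨fun x =>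
    GSet.Hom.toFun (t.inj (Quotient.mk S.orbitSetoid x)) ⟨x, rfl⟩, fun g x => ?_⟩) ?_ ?_
  · exact (key t _ _ (S.mk_smul g x)).symm.trans
      (GSet.Hom.map_smul (t.inj (Quotient.mk S.orbitSetoid x)) g ⟨x, rfl⟩)
  · intro t i
    refine GSet.Hom.ext (funext fun x => (key t i x.1 x.2).symm)
  · intro t m hm
    refine GSet.Hom.ext (funext fun x => ?_)
    exact congrFun (congrArg GSet.Hom.toFun (hm (Quotient.mk _ x))) ⟨x, rfl⟩

variable (Q) in
/-- The subgroups that are the stabilizer of a point in a transitive `G`-set. -/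
abbrev PointStabilizer := {U : Set Q // ∃ (S : GSet.{w} Q) (s : S.carrier),
  (∀ x, ∃ g, S.ρ g s = x) ∧ U = {g | S.ρ g s = s}}

/-- A transitive set is determined up to isomorphism by the stabilizer of one of its points.
Stabilizers are subsets of the small group `Q`, so one representative for each gives a small family,
and every set is the coproduct of its orbits. -/
theorem exists_generators [Small.{w} Q] :
    ∃ (ι : Type w) (Y : ι → GSet.{w} Q), (∀ i, PreGaloisCategory.IsConnected (Y i)) ∧
    ∀ X : GSet.{w} Q,
      (ObjectProperty.ofObj Y).colimitsClosure (fun J : Cat.{w, w} => (J : Type w)) X := by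
  choose S s hs hU using fun U : PointStabilizer.{w} Q => U.2
  refine ⟨Shrink.{w} (PointStabilizer.{w} Q), fun i => S ((equivShrink _).symm i),
    fun i => isConnected_of_transitive _ _ (hs _), fun X => ?_⟩
  refine .of_colimitPresentation (a := Cat.of (Discrete (Quotient X.orbitSetoid)))
    { diag := Discrete.functor X.orbit, ι := (Cofan.mk X X.orbitι).ι, isColimit := X.isColimitOrbits }
    fun j => ?_
  obtain ⟨j⟩ := j
  obtain ⟨t⟩ := X.orbit_nonempty j
  have ht := X.orbit_transitive j t
  let U : PointStabilizer.{w} Q := ⟨_, X.orbit j, t, ht, rfl⟩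
  have hU' : ∀ g, (S U).ρ g (s U) = s U ↔ (X.orbit j).ρ g t = t := fun g =>
    (Set.ext_iff.1 (hU U) g).symm
  obtain ⟨f, hf⟩ := exists_hom_of_stabilizer_le (s U) t (hs U) fun g => (hU' g).1
  have hf' : Function.Bijective (GSet.Hom.toFun f) := by
    constructor
    · intro x y hxy
      obtain ⟨g, rfl⟩ := hs U x
      obtain ⟨g', rfl⟩ := hs U y
      rw [GSet.Hom.map_smul f, GSet.Hom.map_smul f, hf, ← Equiv.Perm.inv_eq_iff_eq, ← map_inv,
        ← Equiv.Perm.mul_apply, ← map_mul, ← hU', map_mul, map_inv, Equiv.Perm.mul_apply,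
        Equiv.Perm.inv_eq_iff_eq] at hxy
      exact hxy
    · intro x
      obtain ⟨g, rfl⟩ := ht x
      exact ⟨(S U).ρ g (s U), by rw [GSet.Hom.map_smul f, hf]⟩
  refine .of_isoClosure (isoOfBijective f hf') (.of_mem _ ?_)
  refine (ObjectProperty.ofObj_iff _ _).2 ⟨equivShrink _ U, ?_⟩
  rw [Equiv.symm_apply_apply]

/-- The group acts on the forgetful functor. -/
def toNoohi : Q →* NoohiCompletion.{w} Q where
  toFun g := NatIso.ofComponents (fun S => (S.ρ g).toIso) (by
    intro S T f
    ext x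
    exact (GSet.Hom.map_smul f g x).symm)
  map_one' := by
    ext S x
    change S.ρ 1 x = x
    rw [map_one]; rfl
  map_mul' g g' := by
    ext S x
    change S.ρ (g * g') x = S.ρ g (S.ρ g' x)
    rw [map_mul]; rfl

/-- The discrete sets with a continuous action of a small topological group form a tame infinite
Galois category. -/
theorem isTameInfiniteGalois_forget [Small.{w} Q] : IsTameInfiniteGalois (GSet.forget.{w} Q) where
  hasColimits := inferInstance
  hasFiniteLimits := inferInstance
  exists_connected_components X := ⟨_, X.orbit, X.orbitι, X.orbit_isConnected, ⟨X.isColimitOrbits⟩⟩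
  exists_generators := exists_generators
  faithful := inferInstance
  reflectsIsomorphisms := inferInstance
  preservesColimits := inferInstance
  preservesFiniteLimits := inferInstance
  transitive X hX x y := by
    obtain ⟨g, hg⟩ := X.transitive_of_isConnected hX x y
    exact ⟨toNoohi g, hg⟩

end GSet

/-! ### Topology and smallness of automorphism groups of functors -/

section Topology

variable {C : Type u₁} [Category.{v₁} C] {F : C ⥤ Type w}

theorem aut_one_app (X : C) (x : F.obj X) : (1 : Aut F).hom.app X x = x := rfl

theorem aut_naturality (σ : Aut F) {X Y : C} (f : X ⟶ Y) (x : F.obj X) :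
    σ.hom.app Y (F.map f x) = F.map f (σ.hom.app X x) :=
  NatTrans.naturality_apply σ.hom f x

theorem aut_ext {σ τ : Aut F} (h : ∀ X x, σ.hom.app X x = τ.hom.app X x) : σ = τ :=
  Iso.ext (NatTrans.ext (funext fun X => ConcreteCategory.hom_ext _ _ (h X)))

instance : T2Space (Aut F) where
  t2 σ τ h := by
    have : ∃ X x, σ.hom.app X x ≠ τ.hom.app X x := by
      by_contra! h'
      exact h (aut_ext h')
    obtain ⟨X, x, hx⟩ := this
    refine ⟨_, _, isOpen_setOf_app_eq X x (σ.hom.app X x),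
      isOpen_setOf_app_eq X x (τ.hom.app X x), rfl, rfl, ?_⟩
    exact Set.disjoint_left.2 fun ρ h₁ h₂ => hx (h₁.symm.trans h₂)

variable (F) in
/-- There are points, and any two points of `F` are images of one point. -/
def PointsDominated : Prop :=
  (∃ X, Nonempty (F.obj X)) ∧ ∀ (X Y : C) (x : F.obj X) (y : F.obj Y),
    ∃ (Z : C) (z : F.obj Z) (f : Z ⟶ X) (g : Z ⟶ Y), F.map f z = x ∧ F.map g z = y

/-- The point stabilizers form a basis of neighbourhoods of the identity. -/
theorem PointsDominated.exists_subset_of_isOpen (hF : PointsDominated F) {U : Set (Aut F)}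
    (hU : IsOpen U) {σ : Aut F} (hσ : σ ∈ U) :
    ∃ (X : C) (x : F.obj X), {τ : Aut F | τ.hom.app X x = σ.hom.app X x} ⊆ U := by
  -- The sets that contain, with each `σ`, all `τ` agreeing with `σ` at some point form a topology,
  -- as any two points are dominated by one. All evaluations are continuous for it, so it is at
  -- least as fine as the given topology.
  let t : TopologicalSpace (Aut F) :=
    { IsOpen U := ∀ σ ∈ U, ∃ (X : C) (x : F.obj X),
        {τ : Aut F | τ.hom.app X x = σ.hom.app X x} ⊆ U
      isOpen_univ := fun σ _ => by
        obtain ⟨X, ⟨x⟩⟩ := hF.1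
        exact ⟨X, x, Set.subset_univ _⟩
      isOpen_inter := by
        rintro U V hU hV σ ⟨h₁, h₂⟩
        obtain ⟨X, x, hx⟩ := hU σ h₁
        obtain ⟨Y, y, hy⟩ := hV σ h₂
        obtain ⟨Z, z, f, g, rfl, rfl⟩ := hF.2 X Y x y
        refine ⟨Z, z, fun τ (hτ : _ = _) => ⟨hx ?_, hy ?_⟩⟩
        · change _ = _
          rw [aut_naturality, aut_naturality, hτ]
        · change _ = _
          rw [aut_naturality, aut_naturality, hτ]
      isOpen_sUnion := by
        rintro S hS σ ⟨U, hU, h⟩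
        obtain ⟨X, x, hx⟩ := hS U hU σ h
        exact ⟨X, x, hx.trans (Set.subset_sUnion_of_mem hU)⟩ }
  have h : t ≤ ⨅ (X : C) (x : F.obj X),
      TopologicalSpace.induced (Y := F.obj X) (fun σ : Aut F => σ.hom.app X x) ⊥ := by
    refine le_iInf fun X => le_iInf fun x => ?_
    rintro _ ⟨A, -, rfl⟩ σ hσ
    exact ⟨X, x, fun τ (hτ : _ = _) => by
      rw [Set.mem_preimage, hτ]; exact hσ⟩
  exact h U hU σ hσ

theorem PointsDominated.dense (hF : PointsDominated F) {A : Set (Aut F)}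
    (hA : ∀ (σ : Aut F) (X : C) (x : F.obj X), ∃ τ ∈ A, τ.hom.app X x = σ.hom.app X x) :
    Dense A := by
  refine dense_iff_inter_open.2 fun U hU ⟨σ, hσ⟩ => ?_
  obtain ⟨X, x, h⟩ := hF.exists_subset_of_isOpen hU hσ
  obtain ⟨τ, hτ, hx⟩ := hA σ X x
  exact ⟨τ, h hx, hτ⟩

/-- A Hausdorff space with a small dense subset is small. -/
theorem small_of_denseRange {T : Type*} [TopologicalSpace T] [T2Space T] {W : Type*} [Small.{w} W]
    {f : W → T} (hf : DenseRange f) : Small.{w} T := by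
  -- A point is recovered from the index sets whose image has it in the closure: if `U` and `V`
  -- separate `s` from `t`, then `f ⁻¹' U` occurs for `s` and not for `t`.
  refine small_of_injective (β := Set (Set W)) (f := fun t => {A | t ∈ closure (f '' A)}) ?_
  intro s t hst
  by_contra hne
  obtain ⟨U, V, hU, hV, hs, ht, hd⟩ := t2_separation hne
  have h₁ : s ∈ closure (f '' (f ⁻¹' U)) := by
    rw [Set.image_preimage_eq_inter_range]
    exact hf.open_subset_closure_inter hU hs
  have h₂ : t ∈ closure (f '' (f ⁻¹' U)) :=
    (Set.ext_iff.1 hst (f ⁻¹' U)).1 h₁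
  obtain ⟨_, hz, z, hz', rfl⟩ := mem_closure_iff.1 h₂ V hV ht
  exact Set.disjoint_left.1 hd hz' hz

/-- As `F` preserves colimits, the fibre of a colimit is covered by the fibres of its diagram. By
naturality, an automorphism of `F` is therefore determined by its values on the generators. -/
theorem IsInfiniteGalois.exists_point_of_generator (hF : IsInfiniteGalois F) {ι : Type w}
    {Y : ι → C} {X : C}
    (hX : (ObjectProperty.ofObj Y).colimitsClosure (fun J : Cat.{w, w} => (J : Type w)) X)
    (x : F.obj X) : ∃ (i : ι) (f : Y i ⟶ X) (y : F.obj (Y i)), F.map f y = x := by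
  have := hF.preservesColimits
  induction hX with
  | of_mem X hX =>
    obtain ⟨i, rfl⟩ := (ObjectProperty.ofObj_iff _ _).1 hX
    exact ⟨i, 𝟙 _, x, by simp⟩
  | of_isoClosure e hX ih =>
    obtain ⟨i, f, y, hy⟩ := ih (F.map e.inv x)
    refine ⟨i, f ≫ e.hom, y, ?_⟩
    rw [Functor.map_comp, ConcreteCategory.comp_apply, hy, ← ConcreteCategory.comp_apply,
      ← Functor.map_comp]
    simp
  | of_colimitPresentation pres h ih =>
    obtain ⟨j, x, rfl⟩ := Types.jointly_surjective_of_isColimit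
      (isColimitOfPreserves F pres.isColimit) x
    obtain ⟨i, f, y, rfl⟩ := ih j x
    exact ⟨i, f ≫ pres.ι.app j, y, by simp⟩

/-- The fundamental group of an infinite Galois category is small. -/
theorem IsInfiniteGalois.small_pi1 (hF : IsInfiniteGalois F) : Small.{w} (Pi1 F) := by
  obtain ⟨ι, Y, -, hY⟩ := hF.exists_generators
  refine small_of_injective (β := ∀ i, F.obj (Y i) → F.obj (Y i))
    (f := fun σ i => σ.hom.app (Y i)) fun σ τ h => aut_ext fun X x => ?_
  obtain ⟨i, f, y, rfl⟩ := hF.exists_point_of_generator (hY X) x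
  rw [aut_naturality, aut_naturality]
  exact congrArg _ (congrFun (congrFun h i) y)

end Topology

/-! ### Tame infinite Galois categories are categories of sets with an action -/

section Tame

variable {C : Type u₁} [Category.{v₁} C] (F : C ⥤ Type w)

/-- A functor to sets takes values in the sets with an action of its automorphism group. -/
def fiberFunctor : C ⥤ GSet.{w} (Pi1 F) where
  obj X :=
    { carrier := F.obj X
      ρ := permHom (fun σ x => σ.hom.app X x) (fun _ => rfl) (fun _ _ _ => rfl)
      isOpen_setOf_eq := isOpen_setOf_app_eq X }
  map f := ⟨F.map f, fun σ x => (aut_naturality σ f x).symm⟩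
  map_id X := GSet.Hom.ext (by simp; rfl)
  map_comp f g := GSet.Hom.ext (by simp; rfl)

variable {F}

theorem map_prod_surjective [HasFiniteLimits C] [PreservesFiniteLimits F] {X Y : C} (x : F.obj X)
    (y : F.obj Y) : ∃ z : F.obj (X ⨯ Y), F.map prod.fst z = x ∧ F.map prod.snd z = y := by
  obtain ⟨l, h₁, h₂⟩ := BinaryFan.IsLimit.lift' (mapIsLimitOfPreservesOfIsLimit F _ _
    (prodIsProd X Y)) (↾fun _ : PUnit => x) (↾fun _ : PUnit => y)
  exact ⟨l ⟨⟩, ConcreteCategory.congr_hom h₁ ⟨⟩, ConcreteCategory.congr_hom h₂ ⟨⟩⟩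

theorem map_prod_ext [HasFiniteLimits C] [PreservesFiniteLimits F] {X Y : C}
    {z z' : F.obj (X ⨯ Y)} (h₁ : F.map prod.fst z = F.map prod.fst z')
    (h₂ : F.map prod.snd z = F.map prod.snd z') : z = z' := by
  have : (↾fun _ : PUnit => z) = (↾fun _ : PUnit => z') := by
    refine BinaryFan.IsLimit.hom_ext (mapIsLimitOfPreservesOfIsLimit F _ _
      (prodIsProd X Y)) ?_ ?_
    · ext; exact h₁
    · ext; exact h₂
  exact ConcreteCategory.congr_hom this ⟨⟩

theorem map_cofan_bijective [PreservesColimitsOfSize.{w, w} F] {ι : Type w} {Y : ι → C} {X : C}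
    {f : ∀ i, Y i ⟶ X} (h : IsColimit (Cofan.mk X f)) :
    Function.Bijective fun p : Σ i, F.obj (Y i) => F.map (f p.1) p.2 :=
  Cofan.nonempty_isColimit_iff_bijective_fromSigma _ |>.1 ⟨isColimitCofanMkObjOfIsColimit F _ _ h⟩

theorem IsInfiniteGalois.pointsDominated (hF : IsInfiniteGalois F) : PointsDominated F := by
  have := hF.hasFiniteLimits
  have := hF.preservesFiniteLimits
  refine ⟨⟨⊤_ C, ?_⟩, fun X Y x y => ?_⟩
  · exact ⟨(IsTerminal.isTerminalObj F _ terminalIsTerminal).from PUnit ⟨⟩⟩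
  · obtain ⟨z, h₁, h₂⟩ := map_prod_surjective x y
    exact ⟨_, z, _, _, h₁, h₂⟩

/-- In a tame infinite Galois category, stable subsets of fibres come from subobjects. -/
theorem IsTameInfiniteGalois.exists_subobject (hF : IsTameInfiniteGalois F) {Z : C}
    (A : Set (F.obj Z)) (hA : ∀ (σ : Pi1 F), ∀ z ∈ A, σ.hom.app Z z ∈ A) :
    ∃ (W : C) (m : W ⟶ Z), Function.Injective (F.map m) ∧ Set.range (F.map m) = A := by
  have := hF.hasColimits
  have := hF.preservesColimits
  obtain ⟨ι, Y, f, hY, ⟨hf⟩⟩ := hF.exists_connected_components Z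
  have hbij := map_cofan_bijective (F := F) hf
  -- By tameness, a stable set contains the whole fibre of each connected component that it meets;
  -- the subobject is the coproduct of these components.
  let ι' := {i // ∃ y : F.obj (Y i), F.map (f i) y ∈ A}
  let Y' : ι' → C := fun i => Y i
  have hbij' := map_cofan_bijective (F := F) (coproductIsCoproduct Y')
  have hm (i : ι') (y : F.obj (Y i)) :
      F.map (Sigma.desc fun i : ι' => f i) (F.map (Sigma.ι Y' i) y) = F.map (f i) y := by
    rw [← ConcreteCategory.comp_apply, ← Functor.map_comp, Sigma.ι_desc]
  refine ⟨∐ Y', Sigma.desc fun i => f i, fun x x' h => ?_, Set.Subset.antisymm ?_ ?_⟩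
  · obtain ⟨⟨i, y⟩, rfl⟩ := hbij'.2 x
    obtain ⟨⟨i', y'⟩, rfl⟩ := hbij'.2 x'
    have := hbij.1 (a₁ := ⟨i, y⟩) (a₂ := ⟨i', y'⟩) ((hm i y).symm.trans (h.trans (hm i' y')))
    obtain ⟨i, hi⟩ := i
    obtain ⟨i', hi'⟩ := i'
    simp only [Sigma.mk.injEq] at this
    obtain ⟨rfl, h⟩ := this
    obtain rfl := eq_of_heq h
    rfl
  · rintro _ ⟨x, rfl⟩
    obtain ⟨⟨⟨i, y₀, h₀⟩, y⟩, rfl⟩ := hbij'.2 x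
    obtain ⟨σ, rfl⟩ := hF.transitive _ (hY i) y₀ y
    have := hA σ _ h₀
    rw [aut_naturality] at this
    exact (congrArg (· ∈ A) (hm ⟨i, y₀, h₀⟩ _)).mpr this
  · intro z hz
    obtain ⟨⟨i, y⟩, rfl⟩ := hbij.2 z
    exact ⟨F.map (Sigma.ι Y' ⟨i, y, hz⟩) y, hm ⟨i, y, hz⟩ y⟩

/-- The graph of an equivariant map is a stable subset of the fibre of `X ⨯ X'`, hence the fibre of
a subobject `W`. Its projection to `X` is bijective on fibres, so an isomorphism, and its inverse
followed by the projection to `X'` induces the map. -/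
theorem IsTameInfiniteGalois.full_fiberFunctor (hF : IsTameInfiniteGalois F) :
    (fiberFunctor F).Full where
  map_surjective {X X'} h := by
    have := hF.hasFiniteLimits
    have := hF.preservesFiniteLimits
    have := hF.reflectsIsomorphisms
    let k : F.obj X → F.obj X' := GSet.Hom.toFun h
    obtain ⟨W, m, hm, hW⟩ := hF.exists_subobject
      {z : F.obj (X ⨯ X') | F.map prod.snd z = k (F.map prod.fst z)} (by
        intro σ z (hz : _ = _)
        change _ = _
        rw [← aut_naturality, ← aut_naturality, hz]
        exact (GSet.Hom.map_smul h σ _).symm)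
    have hW' (x : F.obj W) : F.map (m ≫ prod.snd) x = k (F.map (m ≫ prod.fst) x) := by
      have : F.map m x ∈ _ := hW.subset ⟨x, rfl⟩
      simpa using this
    have hbij : Function.Bijective (F.map (m ≫ prod.fst)) := by
      constructor
      · intro x x' hx
        refine hm (map_prod_ext ?_ ?_)
        · simpa using hx
        · have := (hW' x).trans ((congrArg k hx).trans (hW' x').symm)
          simpa using this
      · intro x
        obtain ⟨z, h₁, h₂⟩ := map_prod_surjective x (k x)
        obtain ⟨x', rfl⟩ : z ∈ Set.range (F.map m) := hW.superset (by
          change _ = _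
          rw [h₁, h₂])
        exact ⟨x', by simpa using h₁⟩
    have : IsIso (F.map (m ≫ prod.fst)) := (isIso_iff_bijective _).2 hbij
    have : IsIso (m ≫ prod.fst) := isIso_of_reflects_iso _ F
    refine ⟨inv (m ≫ prod.fst) ≫ m ≫ prod.snd, GSet.Hom.ext (funext fun (x : F.obj X) => ?_)⟩
    change F.map _ x = k x
    rw [Functor.map_comp, ConcreteCategory.comp_apply, hW', ← ConcreteCategory.comp_apply,
      ← Functor.map_comp]
    simp

theorem IsTameInfiniteGalois.exists_connected_point (hF : IsTameInfiniteGalois F) {X : C}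
    (x : F.obj X) : ∃ (Z : C) (z : F.obj Z) (f : Z ⟶ X),
      F.map f z = x ∧ PreGaloisCategory.IsConnected Z := by
  have := hF.preservesColimits
  obtain ⟨ι, Y, f, hY, ⟨hf⟩⟩ := hF.exists_connected_components X
  obtain ⟨⟨i, y⟩, rfl⟩ := (map_cofan_bijective (F := F) hf).2 x
  exact ⟨Y i, y, f i, rfl, hY i⟩

/-- Every set with a continuous action of the fundamental group is a quotient of a fibre. -/
theorem IsTameInfiniteGalois.exists_cover (hF : IsTameInfiniteGalois F) (S : GSet.{w} (Pi1 F)) :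
    ∃ (Z : C) (p : (fiberFunctor F).obj Z ⟶ S), Function.Surjective (GSet.Hom.toFun p) := by
  have := hF.hasColimits
  have := hF.preservesColimits
  have key (s : S.carrier) : ∃ (Z : C) (p : (fiberFunctor F).obj Z ⟶ S),
      s ∈ Set.range (GSet.Hom.toFun p) := by
    -- The stabilizer of `s` is open, so it contains that of a point `x` of some fibre. A point `z`
    -- above `x` in a connected object has a smaller stabilizer and a transitive fibre, so `z ↦ s`
    -- extends to an equivariant map.
    obtain ⟨X, x, hx⟩ := hF.pointsDominated.exists_subset_of_isOpen (S.isOpen_setOf_eq s s)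
      (σ := 1) (by simp)
    obtain ⟨Z, z, f, rfl, hZ⟩ := hF.exists_connected_point x
    obtain ⟨p, hp⟩ := GSet.exists_hom_of_stabilizer_le (S := (fiberFunctor F).obj Z) (T := S) z s
      (hF.transitive Z hZ z) fun σ (hσ : σ.hom.app Z z = z) => hx (by
        change _ = _
        rw [aut_naturality, hσ, aut_one_app])
    exact ⟨Z, p, z, hp⟩
  choose Z p hp using key
  have hbij := map_cofan_bijective (F := F) (coproductIsCoproduct Z)
  let e := Equiv.ofBijective _ hbij
  refine ⟨∐ Z, ⟨fun x => GSet.Hom.toFun (p (e.symm x).1) (e.symm x).2, fun σ x => ?_⟩, fun s => ?_⟩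
  · obtain ⟨⟨i, y⟩, rfl⟩ := e.surjective x
    have : ((fiberFunctor F).obj (∐ Z)).ρ σ (e ⟨i, y⟩) = e ⟨i, σ.hom.app (Z i) y⟩ :=
      aut_naturality σ _ y
    rw [this, Equiv.symm_apply_apply, Equiv.symm_apply_apply]
    exact GSet.Hom.map_smul (p i) σ y
  · obtain ⟨z, hz⟩ := hp s
    refine ⟨e ⟨s, z⟩, ?_⟩
    change GSet.Hom.toFun (p (e.symm (e ⟨s, z⟩)).1) (e.symm (e ⟨s, z⟩)).2 = s
    rw [Equiv.symm_apply_apply]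
    exact hz

/-- Cover `S` by a fibre of `Z`. The kernel pair of the cover is a stable subset of the fibre of `Z
⨯ Z`, hence comes from some `W`; as `F` preserves coequalizers, the coequalizer of `W ⇉ Z` has fibre
`S`. -/
theorem IsTameInfiniteGalois.essSurj_fiberFunctor (hF : IsTameInfiniteGalois F) :
    (fiberFunctor F).EssSurj where
  mem_essImage S := by
    have := hF.hasColimits
    have := hF.preservesColimits
    have := hF.hasFiniteLimits
    have := hF.preservesFiniteLimits
    obtain ⟨Z, p, hp⟩ := hF.exists_cover S
    let k : F.obj Z → S.carrier := GSet.Hom.toFun p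
    obtain ⟨W, m, hm, hW⟩ := hF.exists_subobject
      {z : F.obj (Z ⨯ Z) | k (F.map prod.fst z) = k (F.map prod.snd z)} (by
        intro σ z (hz : _ = _)
        change _ = _
        rw [← aut_naturality, ← aut_naturality]
        exact (GSet.Hom.map_smul p σ _).trans ((congrArg _ hz).trans
          (GSet.Hom.map_smul p σ _).symm))
    let f : W ⟶ Z := m ≫ prod.fst
    let g : W ⟶ Z := m ≫ prod.snd
    have hfg (x : F.obj W) : k (F.map f x) = k (F.map g x) := by
      have : F.map m x ∈ _ := hW.subset ⟨x, rfl⟩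
      simpa [f, g] using this
    let hc := isColimitCoforkMapOfIsColimit F (coequalizer.condition f g) (coequalizerIsCoequalizer f g)
    obtain ⟨d, hd⟩ := Cofork.IsColimit.desc' hc (↾k) (by ext x; exact hfg x)
    have hπ : Function.Surjective (F.map (coequalizer.π f g)) :=
      (epi_iff_surjective _).1 inferInstance
    have hd' (z : F.obj Z) : d (F.map (coequalizer.π f g) z) = k z :=
      ConcreteCategory.congr_hom hd z
    refine ⟨coequalizer f g, ⟨GSet.isoOfBijective ⟨d, fun σ x => ?_⟩ ⟨fun x x' h => ?_, fun s => ?_⟩⟩⟩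
    · obtain ⟨z, rfl⟩ := hπ x
      change d (σ.hom.app _ (F.map _ z)) = _
      rw [aut_naturality, hd', hd']
      exact GSet.Hom.map_smul p σ z
    · obtain ⟨z, rfl⟩ := hπ x
      obtain ⟨z', rfl⟩ := hπ x'
      obtain ⟨y, h₁, h₂⟩ := map_prod_surjective (F := F) z z'
      obtain ⟨t, rfl⟩ : y ∈ Set.range (F.map m) := hW.superset (by
        change _ = _
        rw [h₁, h₂]
        exact (hd' z).symm.trans (h.trans (hd' z')))
      have h₁' : F.map f t = z := by simpa [f] using h₁
      have h₂' : F.map g t = z' := by simpa [g] using h₂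
      rw [← h₁', ← h₂', ← ConcreteCategory.comp_apply, ← ConcreteCategory.comp_apply,
        ← Functor.map_comp, ← Functor.map_comp, coequalizer.condition]
    · obtain ⟨z, rfl⟩ := hp s
      exact ⟨_, hd' z⟩

theorem IsTameInfiniteGalois.exists_map_eq (hF : IsTameInfiniteGalois F) {X Y : C}
    (h : F.obj X → F.obj Y) (hh : ∀ (σ : Pi1 F) x, h (σ.hom.app X x) = σ.hom.app Y (h x)) :
    ∃ f : X ⟶ Y, ∀ x, F.map f x = h x := by
  have := hF.full_fiberFunctor
  obtain ⟨f, hf⟩ := (fiberFunctor F).map_surjective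
    (show (fiberFunctor F).obj X ⟶ (fiberFunctor F).obj Y from ⟨h, hh⟩)
  exact ⟨f, congrFun (congrArg GSet.Hom.toFun hf)⟩

theorem IsTameInfiniteGalois.exists_iso_map_eq (hF : IsTameInfiniteGalois F) {X Y : C}
    (h : F.obj X ≃ F.obj Y) (hh : ∀ (σ : Pi1 F) x, h (σ.hom.app X x) = σ.hom.app Y (h x)) :
    ∃ f : X ≅ Y, ∀ x, F.map f.hom x = h x := by
  have := hF.reflectsIsomorphisms
  obtain ⟨f, hf⟩ := hF.exists_map_eq h hh
  have : IsIso (F.map f) := (isIso_iff_bijective _).2 (by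
    rw [show ⇑(ConcreteCategory.hom (F.map f)) = h from funext hf]; exact h.bijective)
  have : IsIso f := isIso_of_reflects_iso f F
  exact ⟨asIso f, hf⟩

theorem IsTameInfiniteGalois.exists_equiv (hF : IsTameInfiniteGalois F) {S : Type w}
    (ρ : Pi1 F →* Equiv.Perm S) (hρ : ∀ x y : S, IsOpen {σ | ρ σ x = y}) :
    ∃ (X : C) (e : F.obj X ≃ S), ∀ (σ : Pi1 F) x, e (σ.hom.app X x) = ρ σ (e x) := by
  have := hF.essSurj_fiberFunctor
  let i := (fiberFunctor F).objObjPreimageIso ⟨S, ρ, hρ⟩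
  exact ⟨_, Equiv.ofBijective _ (GSet.bijective_of_isIso i.hom), GSet.Hom.map_smul i.hom⟩

end Tame

/-! ### Topological generators and the Noohi coproduct -/

namespace GSet

variable {Q : Type a} [Group Q] [TopologicalSpace Q]

/-- The elements of the group for which a given map is equivariant. -/
def equivariantSubgroup {S T : GSet.{w} Q} (f : S.carrier → T.carrier) : Subgroup Q where
  carrier := {g | ∀ x, f (S.ρ g x) = T.ρ g (f x)}
  one_mem' := by simp
  mul_mem' {g h} hg hh x := by
    simp only [map_mul, Equiv.Perm.mul_apply]
    rw [hg, hh]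
  inv_mem' {g} hg x := by
    rw [map_inv, map_inv, eq_comm, Equiv.Perm.inv_eq_iff_eq, ← hg, ← Equiv.Perm.mul_apply,
      mul_inv_cancel, Equiv.Perm.one_apply]

/-- A map is equivariant if it is equivariant for topological generators of the group. -/
theorem equivariant_of_dense {S T : GSet.{w} Q} (f : S.carrier → T.carrier) {A : Set Q}
    (hA : Dense (Subgroup.closure A : Set Q)) (hf : ∀ g ∈ A, ∀ x, f (S.ρ g x) = T.ρ g (f x))
    (g : Q) (x : S.carrier) : f (S.ρ g x) = T.ρ g (f x) := by
  have h : Subgroup.closure A ≤ equivariantSubgroup f := (Subgroup.closure_le _).2 hf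
  -- Density gives an element of the subgroup that acts as `g` on both `x` and `f x`.
  obtain ⟨g', hg', h₁, h₂⟩ := hA.exists_mem_open
    ((S.isOpen_setOf_eq x (S.ρ g x)).inter (T.isOpen_setOf_eq (f x) (T.ρ g (f x)))) ⟨g, rfl, rfl⟩
  change S.ρ g' x = _ at h₁
  change T.ρ g' _ = _ at h₂
  rw [← h₁, ← h₂]
  exact h hg' x

end GSet

instance small_freeGroup {X : Type*} [Small.{w} X] : Small.{w} (FreeGroup X) :=
  inferInstanceAs (Small.{w} (Quot _))

theorem small_subgroup_closure {Q : Type*} [Group Q] (A : Set Q) [Small.{w} A] :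
    Small.{w} (Subgroup.closure A) := by
  have : Subgroup.closure A = (FreeGroup.lift (Subtype.val : A → Q)).range := by
    rw [FreeGroup.range_lift_eq_closure, Subtype.range_coe]
  rw [this]
  exact small_of_surjective (MonoidHom.rangeRestrict_surjective _)

namespace TwoSet

variable {G : Type a} [Group G] [TopologicalSpace G] {H : Type b} [Group H] [TopologicalSpace H]

/-- The product of two sets with two actions. -/
def prod (S T : TwoSet.{w} G H) : TwoSet.{w} G H where
  carrier := S.carrier × T.carrier
  ρ₁ := permHom (fun g x => (S.ρ₁ g x.1, T.ρ₁ g x.2)) (by simp) (by simp)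
  ρ₂ := permHom (fun g x => (S.ρ₂ g x.1, T.ρ₂ g x.2)) (by simp) (by simp)
  isOpen_setOf_eq₁ x y := by
    simp only [permHom_apply, Prod.ext_iff]
    exact (S.isOpen_setOf_eq₁ _ _).inter (T.isOpen_setOf_eq₁ _ _)
  isOpen_setOf_eq₂ x y := by
    simp only [permHom_apply, Prod.ext_iff]
    exact (S.isOpen_setOf_eq₂ _ _).inter (T.isOpen_setOf_eq₂ _ _)

/-- The restriction of both actions to a stable subset. -/
def restrict (S : TwoSet.{w} G H) (A : Set S.carrier) (h₁ : ∀ (g : G), ∀ x ∈ A, S.ρ₁ g x ∈ A)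
    (h₂ : ∀ (g : H), ∀ x ∈ A, S.ρ₂ g x ∈ A) : TwoSet.{w} G H where
  carrier := A
  ρ₁ := permHom (fun g x => ⟨S.ρ₁ g x, h₁ g x x.2⟩) (by simp) (by simp)
  ρ₂ := permHom (fun g x => ⟨S.ρ₂ g x, h₂ g x x.2⟩) (by simp) (by simp)
  isOpen_setOf_eq₁ x y := by
    simp only [permHom_apply, Subtype.ext_iff]
    exact S.isOpen_setOf_eq₁ x y
  isOpen_setOf_eq₂ x y := by
    simp only [permHom_apply, Subtype.ext_iff]
    exact S.isOpen_setOf_eq₂ x y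

variable (G H) in
theorem pointsDominated_forget : PointsDominated (TwoSet.forget.{w} G H) :=
  ⟨⟨⟨PUnit, 1, 1, by simp, by simp⟩, ⟨PUnit.unit⟩⟩, fun S T s t => ⟨S.prod T, (s, t),
    ⟨Prod.fst, fun _ _ => rfl, fun _ _ => rfl⟩, ⟨Prod.snd, fun _ _ => rfl, fun _ _ => rfl⟩,
    rfl, rfl⟩⟩

end TwoSet

namespace NoohiCoprod

variable {G : Type a} [Group G] [TopologicalSpace G] {H : Type b} [Group H] [TopologicalSpace H]

/-- The two groups topologically generate their Noohi coproduct. -/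
theorem dense_closure : Dense (Subgroup.closure
    (Set.range (inl : G → NoohiCoprod.{w} G H) ∪ Set.range (inr : H → NoohiCoprod.{w} G H)) :
      Set (NoohiCoprod.{w} G H)) := by
  refine (TwoSet.pointsDominated_forget G H).dense fun σ S x => ?_
  let B := Subgroup.closure
    (Set.range (inl : G → NoohiCoprod.{w} G H) ∪ Set.range (inr : H → NoohiCoprod.{w} G H))
  -- The orbit of `x` under the generated subgroup is stable under both groups, so its inclusion
  -- into `S` is a morphism; naturality of `σ` keeps `σ x` in it.
  let A : Set S.carrier := {y | ∃ τ ∈ B, τ.hom.app S x = y}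
  let T := S.restrict A
    (by
      rintro g _ ⟨τ, hτ, rfl⟩
      exact ⟨inl g * τ, mul_mem (Subgroup.subset_closure (.inl ⟨g, rfl⟩)) hτ, rfl⟩)
    (by
      rintro g _ ⟨τ, hτ, rfl⟩
      exact ⟨inr g * τ, mul_mem (Subgroup.subset_closure (.inr ⟨g, rfl⟩)) hτ, rfl⟩)
  let i : T ⟶ S := ⟨Subtype.val, fun _ _ => rfl, fun _ _ => rfl⟩
  let t : (TwoSet.forget G H).obj T := ⟨x, 1, one_mem _, rfl⟩
  have : σ.hom.app S x = (show A from σ.hom.app T t).1 := aut_naturality σ i t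
  rw [this]
  exact (show A from σ.hom.app T t).2

instance [Small.{w} G] [Small.{w} H] : Small.{w} (NoohiCoprod.{w} G H) := by
  have : Small.{w} (Subgroup.closure (Set.range (inl : G → NoohiCoprod.{w} G H) ∪
      Set.range (inr : H → NoohiCoprod.{w} G H))) := small_subgroup_closure _
  exact small_of_denseRange (dense_closure (G := G) (H := H)).denseRange_val

/-- Maps that are equivariant for both groups are equivariant for the Noohi coproduct. -/
theorem equivariant {S T : GSet.{w} (NoohiCoprod.{w} G H)} (f : S.carrier → T.carrier)
    (h₁ : ∀ g x, f (S.ρ (inl g) x) = T.ρ (inl g) (f x))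
    (h₂ : ∀ g x, f (S.ρ (inr g) x) = T.ρ (inr g) (f x))
    (g : NoohiCoprod.{w} G H) (x : S.carrier) : f (S.ρ g x) = T.ρ g (f x) := by
  refine GSet.equivariant_of_dense f dense_closure ?_ g x
  rintro _ (⟨g, rfl⟩ | ⟨g, rfl⟩) x
  exacts [h₁ g x, h₂ g x]

end NoohiCoprod

/-! ### Invariance under equivalence -/

section Equivalence

theorem isConnected_of_equivalence {C : Type u₁} [Category.{v₁} C] {D : Type u₂} [Category.{v₂} D]
    (e : C ≌ D) {X : C} (hX : PreGaloisCategory.IsConnected X) :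
    PreGaloisCategory.IsConnected (e.functor.obj X) where
  notInitial h := hX.notInitial (IsInitial.isInitialOfObj e.functor X h)
  noTrivialComponent Y i _ hY := by
    have := hX.noTrivialComponent (e.inverse.obj Y) (e.inverse.map i ≫ (e.unitIso.app X).inv)
      fun h => hY (IsInitial.isInitialOfObj e.inverse Y h)
    have : IsIso (e.inverse.map i) := IsIso.of_isIso_comp_right _ (e.unitIso.app X).inv
    exact isIso_of_reflects_iso i e.inverse

theorem colimitsClosure_of_preservesColimits {C : Type u₁} [Category.{v₁} C] {D : Type u₂}
    [Category.{v₂} D] (K : C ⥤ D) [PreservesColimitsOfSize.{w, w} K] {ι : Type w} {Y : ι → C} {X : C}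
    (hX : (ObjectProperty.ofObj Y).colimitsClosure (fun J : Cat.{w, w} => (J : Type w)) X) :
    (ObjectProperty.ofObj fun i => K.obj (Y i)).colimitsClosure
      (fun J : Cat.{w, w} => (J : Type w)) (K.obj X) := by
  induction hX with
  | of_mem X hX =>
    obtain ⟨i, rfl⟩ := (ObjectProperty.ofObj_iff _ _).1 hX
    exact .of_mem _ ((ObjectProperty.ofObj_iff _ _).2 ⟨i, rfl⟩)
  | of_isoClosure e hX ih => exact .of_isoClosure (K.mapIso e) ih
  | of_colimitPresentation pres h ih => exact .of_colimitPresentation (pres.map K) ih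

variable {C : Type u₁} [Category.{v₁} C] {D : Type u₂} [Category.{v₂} D] {F : C ⥤ Type w}
  {G : D ⥤ Type w}

@[simp]
theorem pi1Map_app (u : C ⥤ D) (α : u ⋙ G ≅ F) (σ : Pi1 G) (X : C) (x : F.obj X) :
    (pi1Map u α σ).hom.app X x = α.hom.app X (σ.hom.app (u.obj X) (α.inv.app X x)) := rfl

theorem pi1Map_injective (u : C ⥤ D) [u.EssSurj] (α : u ⋙ G ≅ F) :
    Function.Injective (pi1Map u α) := by
  intro σ τ h
  refine aut_ext fun Y y => ?_
  have key : ∀ X (x : G.obj (u.obj X)), σ.hom.app _ x = τ.hom.app _ x := fun X x => by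
    have h₁ := congrArg (fun σ : Pi1 F => σ.hom.app X (α.hom.app X x)) h
    simp only [pi1Map_app] at h₁
    have h₂ : α.inv.app X (α.hom.app X x) = x := Iso.hom_inv_id_app_apply α X x
    rw [h₂] at h₁
    exact (isIso_iff_bijective (α.hom.app X)).1 inferInstance |>.1 h₁
  let i := u.objObjPreimageIso Y
  obtain ⟨x, rfl⟩ : ∃ x, G.map i.hom x = y := ⟨G.map i.inv y, by simp [← ConcreteCategory.comp_apply, ← Functor.map_comp]⟩
  rw [aut_naturality, aut_naturality, key]

/-- An equivalence compatible with the fibre functors induces an isomorphism of fundamental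
groups. -/
theorem nonempty_pi1_equiv (e : C ≌ D) (α : e.functor ⋙ G ≅ F) : Nonempty (Pi1 F ≃ₜ* Pi1 G) := by
  let β : e.inverse ⋙ F ≅ G := Functor.isoWhiskerLeft e.inverse α.symm ≪≫
    (Functor.associator _ _ _).symm ≪≫ Functor.isoWhiskerRight e.counitIso G ≪≫ G.leftUnitor
  -- Only this composite has to be computed; the other one follows from the injectivity of `pi1Map
  -- e.inverse β`.
  have h (σ : Pi1 G) : pi1Map e.inverse β (pi1Map e.functor α σ) = σ := by
    refine aut_ext fun Y y => ?_
    have hβ (y : F.obj (e.inverse.obj Y)) :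
        β.hom.app Y y = G.map (e.counit.app Y) (α.inv.app _ y) := by
      simp [β]
    obtain ⟨z, rfl⟩ : ∃ z, β.hom.app Y z = y := ⟨_, Iso.inv_hom_id_app_apply β Y y⟩
    have h₁ : β.inv.app Y (β.hom.app Y z) = z := Iso.hom_inv_id_app_apply β Y z
    rw [pi1Map_app, h₁, pi1Map_app, hβ, hβ, aut_naturality]
    congr 1
    exact Iso.hom_inv_id_app_apply α _ _
  exact ⟨{ toFun := pi1Map e.inverse β
           invFun := pi1Map e.functor α
           left_inv := fun σ => pi1Map_injective e.inverse β (h _)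
           right_inv := h
           map_mul' := map_mul _
           continuous_toFun := (pi1Map e.inverse β).continuous_toFun
           continuous_invFun := (pi1Map e.functor α).continuous_toFun }⟩

/-- Being a tame infinite Galois category is invariant under equivalence. -/
theorem IsTameInfiniteGalois.of_equivalence (hG : IsTameInfiniteGalois G) (e : C ≌ D)
    (α : e.functor ⋙ G ≅ F) : IsTameInfiniteGalois F where
  hasColimits := by
    have := hG.hasColimits
    exact Adjunction.has_colimits_of_equivalence e.functor
  hasFiniteLimits := by
    have := hG.hasFiniteLimits
    exact ⟨fun J _ _ => Adjunction.hasLimitsOfShape_of_equivalence e.functor⟩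
  exists_connected_components X := by
    obtain ⟨ι, Y, f, hY, ⟨hf⟩⟩ := hG.exists_connected_components (e.functor.obj X)
    refine ⟨ι, fun i => e.inverse.obj (Y i), fun i => e.inverse.map (f i) ≫ e.unitInv.app X,
      fun i => isConnected_of_equivalence e.symm (hY i), ⟨?_⟩⟩
    refine IsColimit.ofIsoColimit (isColimitCofanMkObjOfIsColimit e.inverse _ _ hf)
      (Cofan.ext (e.unitIso.app X).symm fun i => rfl)
  exists_generators := by
    obtain ⟨ι, Y, hY, h⟩ := hG.exists_generators
    exact ⟨ι, fun i => e.inverse.obj (Y i), fun i => isConnected_of_equivalence e.symm (hY i),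
      fun X => .of_isoClosure (e.unitIso.app X).symm (colimitsClosure_of_preservesColimits e.inverse
        (h (e.functor.obj X)))⟩
  faithful := by
    have := hG.faithful
    exact Functor.Faithful.of_iso α
  reflectsIsomorphisms := by
    have := hG.reflectsIsomorphisms
    exact reflectsIsomorphisms_of_iso α
  preservesColimits := by
    have := hG.preservesColimits
    exact preservesColimits_of_natIso α
  preservesFiniteLimits := by
    have := hG.preservesFiniteLimits
    exact preservesFiniteLimits_of_natIso α
  transitive X hX x y := by
    obtain ⟨σ, hσ⟩ := hG.transitive _ (isConnected_of_equivalence e hX) (α.inv.app X x)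
      (α.inv.app X y)
    refine ⟨pi1Map e.functor α σ, ?_⟩
    rw [pi1Map_app, hσ]
    exact Iso.inv_hom_id_app_apply α X y

end Equivalence

/-- The restriction of a `G`-set along a continuous homomorphism. -/
def GSet.res {Q : Type a} [Group Q] [TopologicalSpace Q] {Q' : Type b} [Group Q']
    [TopologicalSpace Q'] (f : Q' →ₜ* Q) (S : GSet.{w} Q) : GSet.{w} Q' where
  carrier := S.carrier
  ρ := S.ρ.comp f.toMonoidHom
  isOpen_setOf_eq x y := (S.isOpen_setOf_eq x y).preimage f.continuous_toFun

/-! ### The group of edges -/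

namespace EdgeGroup

variable {s : ℕ}

theorem u_mul_u (i j k : Fin s) : u i j * u j k = u i k := by
  rw [← mul_inv_eq_one]
  exact PresentedGroup.one_of_mem (rels := edgeRels s) (.inr ⟨i, j, k, rfl⟩)

theorem v_zero [NeZero s] : v (0 : Fin s) = 1 :=
  PresentedGroup.one_of_mem (rels := edgeRels s) (.inl ⟨0, rfl⟩)

/-- The relation `u 0 i * u i j = u 0 j` gives `u i j = (v i)⁻¹ * v j`. -/
theorem closure_range_v [NeZero s] : Subgroup.closure (Set.range (v : Fin s → EdgeGroup s)) = ⊤ := by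
  refine top_unique ((PresentedGroup.closure_range_of (edgeRels s)).ge.trans
    ((Subgroup.closure_le _).2 ?_))
  rintro _ ⟨⟨i, j⟩, rfl⟩
  have : (PresentedGroup.of (i, j) : PresentedGroup (edgeRels s)) = (v i)⁻¹ * v j :=
    eq_inv_mul_of_mul_eq (u_mul_u 0 i j)
  rw [this]
  exact mul_mem (inv_mem (Subgroup.subset_closure ⟨i, rfl⟩)) (Subgroup.subset_closure ⟨j, rfl⟩)

instance : DiscreteTopology (EdgeGroup s) := ⟨rfl⟩

instance : Small.{w} (EdgeGroup s) :=
  inferInstanceAs (Small.{w} (Quotient (QuotientGroup.leftRel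
    (Subgroup.normalClosure (edgeRels s)))))

/-- Bijections `b i` give an action in which `u i j` acts through `(b i)⁻¹ ∘ b j`. -/
def toPerm {S T : Type*} (b : Fin s → S ≃ T) : EdgeGroup s →* Equiv.Perm S :=
  PresentedGroup.toGroup (f := fun p : Fin s × Fin s => (b p.2).trans (b p.1).symm) (by
    rintro _ (⟨i, rfl⟩ | ⟨i, j, k, rfl⟩)
    · ext; simp
    · simp only [map_mul, map_inv, FreeGroup.lift_apply_of, mul_inv_eq_one]
      ext; simp)

theorem toPerm_v [NeZero s] {S T : Type*} (b : Fin s → S ≃ T) (i : Fin s) :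
    toPerm b (v i) = (b i).trans (b 0).symm :=
  PresentedGroup.toGroup.of _

end EdgeGroup

/-! ### Actions of the Van Kampen quotient as gluing data -/

section VK

variable {s : ℕ} [NeZero s] {P : Type a} [Group P] [TopologicalSpace P]
  {P' : Type b} [Group P'] [TopologicalSpace P']
  {P'' : Fin s → Type c} [∀ i, Group (P'' i)] [∀ i, TopologicalSpace (P'' i)]
  (ψ : ∀ i, P'' i →ₜ* P) (φ : ∀ i, P'' i →ₜ* P')

/-- The quotient of the Noohi coproduct whose completion is the Noohi Van Kampen group. -/
abbrev VKQuotient :=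
  VKCoprod.{w} s P P' ⧸ Subgroup.normalClosure (Subgroup.closure (Set.range fun p : Σ i, P'' i =>
    (NoohiCoprod.inl (ψ p.1 p.2) : VKCoprod.{w} s P P')⁻¹ *
      NoohiCoprod.inr ((NoohiCoprod.inr (EdgeGroup.v p.1))⁻¹ * NoohiCoprod.inl (φ p.1 p.2) *
        NoohiCoprod.inr (EdgeGroup.v p.1))) : Set (VKCoprod.{w} s P P'))

namespace VKQuotient

/-- The quotient map. -/
def mk : VKCoprod.{w} s P P' →ₜ* VKQuotient.{w} ψ φ where
  toMonoidHom := QuotientGroup.mk' _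
  continuous_toFun := continuous_quotient_mk'

/-- The map from the first group. -/
def ofLeft : P →ₜ* VKQuotient.{w} ψ φ := (mk ψ φ).comp NoohiCoprod.inl

/-- The map from the second group. -/
def ofRight : P' →ₜ* VKQuotient.{w} ψ φ :=
  (mk ψ φ).comp (NoohiCoprod.inr.comp NoohiCoprod.inl)

/-- The map from the group of edges. -/
def ofEdge : EdgeGroup s →ₜ* VKQuotient.{w} ψ φ :=
  (mk ψ φ).comp (NoohiCoprod.inr.comp NoohiCoprod.inr)

theorem ofEdge_mul_ofLeft (i : Fin s) (g : P'' i) :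
    ofEdge ψ φ (EdgeGroup.v i) * ofLeft.{w} ψ φ (ψ i g) =
      ofRight ψ φ (φ i g) * ofEdge ψ φ (EdgeGroup.v i) := by
  have h : ofLeft.{w} ψ φ (ψ i g) = (ofEdge ψ φ (EdgeGroup.v i))⁻¹ * ofRight ψ φ (φ i g) *
      ofEdge ψ φ (EdgeGroup.v i) := by
    have h : mk ψ φ (NoohiCoprod.inl (ψ i g)) = mk ψ φ (NoohiCoprod.inr
        ((NoohiCoprod.inr (EdgeGroup.v i))⁻¹ * NoohiCoprod.inl (φ i g) *
          NoohiCoprod.inr (EdgeGroup.v i))) :=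
      QuotientGroup.eq.2 (Subgroup.subset_normalClosure
        (Subgroup.subset_closure ⟨⟨i, g⟩, rfl⟩))
    rw [map_mul, map_mul, map_mul, map_mul, map_inv, map_inv] at h
    exact h
  rw [h]
  group

instance [Small.{w} P] [Small.{w} P'] : Small.{w} (VKQuotient.{w} ψ φ) :=
  small_of_surjective (QuotientGroup.mk'_surjective _)

variable {ψ φ}

/-- The density argument applies to the outer and then to the inner Noohi coproduct; the edge group
is generated by the `v i`. -/
theorem equivariant {S T : GSet.{w} (VKQuotient.{w} ψ φ)} (f : S.carrier → T.carrier)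
    (h₁ : ∀ g x, f (S.ρ (ofLeft ψ φ g) x) = T.ρ (ofLeft ψ φ g) (f x))
    (h₂ : ∀ g x, f (S.ρ (ofRight ψ φ g) x) = T.ρ (ofRight ψ φ g) (f x))
    (h₃ : ∀ i x, f (S.ρ (ofEdge ψ φ (EdgeGroup.v i)) x) =
      T.ρ (ofEdge ψ φ (EdgeGroup.v i)) (f x))
    (g : VKQuotient.{w} ψ φ) (x : S.carrier) : f (S.ρ g x) = T.ρ g (f x) := by
  obtain ⟨g, rfl⟩ := QuotientGroup.mk'_surjective _ g
  refine NoohiCoprod.equivariant (S := S.res (mk ψ φ)) (T := T.res (mk ψ φ)) f h₁ (fun g x => ?_) g x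
  refine NoohiCoprod.equivariant (S := (S.res (mk ψ φ)).res NoohiCoprod.inr)
    (T := (T.res (mk ψ φ)).res NoohiCoprod.inr) f h₂ (fun g x => ?_) g x
  refine GSet.equivariant_of_dense (S := S.res (ofEdge ψ φ)) (T := T.res (ofEdge ψ φ)) f
    (A := Set.range EdgeGroup.v) ?_ ?_ g x
  · rw [EdgeGroup.closure_range_v]
    exact dense_univ
  · rintro _ ⟨i, rfl⟩ x
    exact h₃ i x

end VKQuotient

variable {ψ φ} (S : GSet.{w} P) (T : GSet.{w} P') (b : Fin s → S.carrier ≃ T.carrier)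

/-- The Noohi coproduct of the second group and the group of edges acts on the first set through
given bijections. -/
def transportedTwoSet : TwoSet.{w} P' (EdgeGroup s) where
  carrier := S.carrier
  ρ₁ := permHom (fun g x => (b 0).symm (T.ρ g (b 0 x))) (by simp) (by simp)
  ρ₂ := EdgeGroup.toPerm b
  isOpen_setOf_eq₁ x y := by
    simp only [permHom_apply, Equiv.symm_apply_eq]
    exact T.isOpen_setOf_eq _ _
  isOpen_setOf_eq₂ _ _ := isOpen_discrete _

/-- The action of the Noohi coproduct of the two groups and the group of edges attached to
bijections between sets with an action of the two groups. -/
def gluedTwoSet : TwoSet.{w} P (NoohiCoprod.{w} P' (EdgeGroup s)) where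
  carrier := S.carrier
  ρ₁ := S.ρ
  -- The Noohi coproduct is an automorphism group of a forgetful functor, so it acts tautologically
  -- on every set with two actions.
  ρ₂ := ((fiberFunctor (TwoSet.forget.{w} P' (EdgeGroup s))).obj (transportedTwoSet S T b)).ρ
  isOpen_setOf_eq₁ := S.isOpen_setOf_eq
  isOpen_setOf_eq₂ := ((fiberFunctor (TwoSet.forget.{w} P' (EdgeGroup s))).obj
    (transportedTwoSet S T b)).isOpen_setOf_eq

/-- The `VKQuotient`-set glued from sets with an action of the two groups along bijections
compatible with the homomorphisms `ψ i` and `φ i`. -/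
def gluedGSet (hb : ∀ i (g : P'' i) x, b i (S.ρ (ψ i g) x) = T.ρ (φ i g) (b i x)) :
    GSet.{w} (VKQuotient.{w} ψ φ) where
  carrier := S.carrier
  ρ := QuotientGroup.lift _
    ((fiberFunctor (TwoSet.forget.{w} P (NoohiCoprod.{w} P' (EdgeGroup s)))).obj
      (gluedTwoSet S T b)).ρ (by
    refine Subgroup.normalClosure_le_normal (N := MonoidHom.ker _) ((Subgroup.closure_le _).2 ?_)
    rintro _ ⟨⟨i, g⟩, rfl⟩
    let ρ := ((fiberFunctor (TwoSet.forget.{w} P (NoohiCoprod.{w} P' (EdgeGroup s)))).obj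
      (gluedTwoSet S T b)).ρ
    refine (map_mul ρ _ _).trans ((congrArg (· * _) (map_inv ρ _)).trans (inv_mul_eq_one.2 ?_))
    refine Equiv.ext fun (x : S.carrier) => ?_
    -- As `v i` acts by `(b 0)⁻¹ ∘ b i`, the right side is `(b i)⁻¹ ∘ φ i g ∘ b i`: the bijection `b
    -- 0` cancels and `hb` remains.
    change S.ρ (ψ i g) x = ((EdgeGroup.toPerm b (EdgeGroup.v i))⁻¹ : Equiv.Perm _)
      ((b 0).symm (T.ρ (φ i g) (b 0 (EdgeGroup.toPerm b (EdgeGroup.v i) x))))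
    rw [EdgeGroup.toPerm_v, eq_comm, Equiv.Perm.inv_eq_iff_eq]
    simp [hb])
  isOpen_setOf_eq x y := isOpen_coinduced.2
    (((fiberFunctor (TwoSet.forget.{w} P (NoohiCoprod.{w} P' (EdgeGroup s)))).obj
      (gluedTwoSet S T b)).isOpen_setOf_eq x y)

variable (hb : ∀ i (g : P'' i) x, b i (S.ρ (ψ i g) x) = T.ρ (φ i g) (b i x))

theorem gluedGSet_ofEdge (i : Fin s) (x : S.carrier) :
    (gluedGSet S T b hb).ρ (VKQuotient.ofEdge ψ φ (EdgeGroup.v i)) x = (b 0).symm (b i x) :=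
  congrArg (fun f : Equiv.Perm S.carrier => f x) (EdgeGroup.toPerm_v b i)

section Hom

variable {S T b hb} {S' : GSet.{w} P} {T' : GSet.{w} P'} {b' : Fin s → S'.carrier ≃ T'.carrier}
  {hb' : ∀ i (g : P'' i) x, b' i (S'.ρ (ψ i g) x) = T'.ρ (φ i g) (b' i x)}

/-- The map of glued sets given by compatible equivariant maps. -/
def gluedHom (k : S ⟶ S') (l : T ⟶ T') (h : ∀ i x, b' i (k.toFun x) = l.toFun (b i x)) :
    gluedGSet S T b hb ⟶ gluedGSet S' T' b' hb' where
  toFun := k.toFun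
  map_smul := by
    have h₀ (y) : k.toFun ((b 0).symm y) = (b' 0).symm (l.toFun y) := by
      rw [Equiv.eq_symm_apply, h, Equiv.apply_symm_apply]
    refine VKQuotient.equivariant (S := gluedGSet S T b hb) (T := gluedGSet S' T' b' hb')
      k.toFun k.map_smul (fun g x => ?_) fun i x => ?_
    · exact (h₀ _).trans (congrArg (b' 0).symm
        ((l.map_smul g _).trans (congrArg (T'.ρ g) (h 0 x).symm)))
    · refine (congrArg k.toFun (gluedGSet_ofEdge S T b hb i x)).trans
        (Eq.trans ?_ (gluedGSet_ofEdge S' T' b' hb' i (k.toFun x)).symm)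
      exact (h₀ _).trans (congrArg (b' 0).symm (h i x).symm)

/-- The first component of a map of glued sets. -/
def gluedHomLeft (k : gluedGSet S T b hb ⟶ gluedGSet S' T' b' hb') : S ⟶ S' where
  toFun := k.toFun
  map_smul g x := k.map_smul (VKQuotient.ofLeft ψ φ g) x

/-- The second component of a map of glued sets. -/
def gluedHomRight (k : gluedGSet S T b hb ⟶ gluedGSet S' T' b' hb') : T ⟶ T' where
  toFun y := b' 0 (k.toFun ((b 0).symm y))
  map_smul g y := by
    have h : k.toFun ((b 0).symm (T.ρ g (b 0 ((b 0).symm y)))) = _ :=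
      k.map_smul (VKQuotient.ofRight ψ φ g) ((b 0).symm y)
    rw [Equiv.apply_symm_apply] at h
    exact (Equiv.eq_symm_apply (b' 0)).1 h

/-- The second component is defined through `b 0` alone. Its compatibility with the other `b i` is
the equivariance under the edge `v i`. -/
theorem gluedHomRight_apply (k : gluedGSet S T b hb ⟶ gluedGSet S' T' b' hb') (i : Fin s)
    (x : S.carrier) :
    b' i ((gluedHomLeft k).toFun x) = (gluedHomRight k).toFun (b i x) := by
  have h := (congrArg k.toFun (gluedGSet_ofEdge S T b hb i x)).symm.trans
    ((k.map_smul (VKQuotient.ofEdge ψ φ (EdgeGroup.v i)) x).trans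
      (gluedGSet_ofEdge S' T' b' hb' i (k.toFun x)))
  exact ((Equiv.eq_symm_apply (b' 0)).1 h).symm

end Hom

section Iso

variable {S T} {R : GSet.{w} (VKQuotient.{w} ψ φ)} (e : S.carrier ≃ R.carrier)
  (e' : T.carrier ≃ R.carrier)

/-- The bijection through which the edge `v i` acts. -/
def edgeEquiv (i : Fin s) : S.carrier ≃ T.carrier :=
  (e.trans (R.ρ (VKQuotient.ofEdge ψ φ (EdgeGroup.v i)))).trans e'.symm

theorem apply_edgeEquiv (i : Fin s) (x : S.carrier) :
    e' (edgeEquiv e e' i x) = R.ρ (VKQuotient.ofEdge ψ φ (EdgeGroup.v i)) (e x) :=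
  e'.apply_symm_apply _

theorem apply_edgeEquiv_zero (x : S.carrier) : e' (edgeEquiv e e' 0 x) = e x := by
  rw [apply_edgeEquiv, EdgeGroup.v_zero, map_one, map_one, Equiv.Perm.one_apply]

theorem apply_edgeEquiv_zero_symm (y : T.carrier) : e ((edgeEquiv e e' 0).symm y) = e' y := by
  rw [← apply_edgeEquiv_zero e e', Equiv.apply_symm_apply]

variable {e e'} (he : ∀ g x, e (S.ρ g x) = R.ρ (VKQuotient.ofLeft ψ φ g) (e x))
  (he' : ∀ g x, e' (T.ρ g x) = R.ρ (VKQuotient.ofRight ψ φ g) (e' x))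

-- This is the defining relation of the quotient, in the form `ofEdge_mul_ofLeft`, read on `R`.
include he he' in
theorem edgeEquiv_smul (i : Fin s) (g : P'' i) (x : S.carrier) :
    edgeEquiv e e' i (S.ρ (ψ i g) x) = T.ρ (φ i g) (edgeEquiv e e' i x) := by
  apply e'.injective
  rw [apply_edgeEquiv, he, he', apply_edgeEquiv, ← Equiv.Perm.mul_apply, ← map_mul,
    VKQuotient.ofEdge_mul_ofLeft, map_mul, Equiv.Perm.mul_apply]

include he he' in
/-- Every set with an action of the Van Kampen quotient is glued. -/
theorem nonempty_gluedIso (h : ∀ i, b i = edgeEquiv e e' i) : Nonempty (gluedGSet S T b hb ≅ R) := by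
  obtain rfl : b = edgeEquiv e e' := funext h
  exact ⟨GSet.isoOfBijective ⟨e, VKQuotient.equivariant (S := gluedGSet S T (edgeEquiv e e') hb) e he
    (fun g x => (apply_edgeEquiv_zero_symm e e' _).trans
      ((he' g _).trans (congrArg (R.ρ _) (apply_edgeEquiv_zero e e' x))))
    fun i x => (congrArg e (gluedGSet_ofEdge S T _ _ i x)).trans
      ((apply_edgeEquiv_zero_symm e e' _).trans (apply_edgeEquiv e e' i x))⟩ e.bijective⟩

end Iso

end VK

/-! ### Isomorphisms over `E` as bijections of fibres -/

section Transport

variable {C : Type u₁} [Category.{v₁} C] {D : Type u₂} [Category.{v₂} D]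
  {E : Type u₃} [Category.{v₃} E] {F : C ⥤ Type w} {G : D ⥤ Type w} {H : E ⥤ Type w}
  {u : C ⥤ E} {v : D ⥤ E} (α : u ⋙ H ≅ F) (β : v ⋙ H ≅ G)

/-- The bijection between the fibres of an object and of its image. -/
def fibreEquiv (X : C) : H.obj (u.obj X) ≃ F.obj X := (α.app X).toEquiv

theorem fibreEquiv_map {X Y : C} (f : X ⟶ Y) (x : H.obj (u.obj X)) :
    fibreEquiv α Y (H.map (u.map f) x) = F.map f (fibreEquiv α X x) :=
  NatTrans.naturality_apply α.hom f x

theorem pi1Map_fibreEquiv (X : C) (σ : Pi1 H) (x : H.obj (u.obj X)) :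
    (pi1Map u α σ).hom.app X (fibreEquiv α X x) = fibreEquiv α X (σ.hom.app (u.obj X) x) :=
  congrArg (fun y => fibreEquiv α X (σ.hom.app (u.obj X) y)) ((fibreEquiv α X).symm_apply_apply x)

/-- The bijection of fibres given by an isomorphism between the images of two objects. -/
def fibreTransport {X : C} {Y : D} (f : u.obj X ≅ v.obj Y) : F.obj X ≃ G.obj Y :=
  ((fibreEquiv α X).symm.trans (H.mapIso f).toEquiv).trans (fibreEquiv β Y)

theorem fibreTransport_fibreEquiv {X : C} {Y : D} (f : u.obj X ≅ v.obj Y) (x : H.obj (u.obj X)) :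
    fibreTransport α β f (fibreEquiv α X x) = fibreEquiv β Y (H.map f.hom x) :=
  congrArg (fun y => fibreEquiv β Y (H.map f.hom y)) ((fibreEquiv α X).symm_apply_apply x)

theorem fibreTransport_smul {X : C} {Y : D} (f : u.obj X ≅ v.obj Y) (σ : Pi1 H) (x : F.obj X) :
    fibreTransport α β f ((pi1Map u α σ).hom.app X x) =
      (pi1Map v β σ).hom.app Y (fibreTransport α β f x) := by
  obtain ⟨x, rfl⟩ := (fibreEquiv α X).surjective x
  rw [pi1Map_fibreEquiv, fibreTransport_fibreEquiv, fibreTransport_fibreEquiv, pi1Map_fibreEquiv,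
    aut_naturality]

theorem fibreTransport_map {X X' : C} {Y Y' : D} (f : u.obj X ≅ v.obj Y) (f' : u.obj X' ≅ v.obj Y')
    (g : X ⟶ X') (h : Y ⟶ Y') (w : u.map g ≫ f'.hom = f.hom ≫ v.map h) (x : F.obj X) :
    fibreTransport α β f' (F.map g x) = G.map h (fibreTransport α β f x) := by
  obtain ⟨x, rfl⟩ := (fibreEquiv α X).surjective x
  rw [← fibreEquiv_map, fibreTransport_fibreEquiv, fibreTransport_fibreEquiv, ← fibreEquiv_map,
    ← ConcreteCategory.comp_apply, ← ConcreteCategory.comp_apply, ← Functor.map_comp,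
    ← Functor.map_comp, w]

theorem comm_of_fibreTransport_map [H.Faithful] {X X' : C} {Y Y' : D} (f : u.obj X ≅ v.obj Y)
    (f' : u.obj X' ≅ v.obj Y') (g : X ⟶ X') (h : Y ⟶ Y')
    (w : ∀ x, fibreTransport α β f' (F.map g x) = G.map h (fibreTransport α β f x)) :
    u.map g ≫ f'.hom = f.hom ≫ v.map h := by
  refine H.map_injective (ConcreteCategory.hom_ext _ _ fun x => (fibreEquiv β Y').injective ?_)
  have := w (fibreEquiv α X x)
  rw [← fibreEquiv_map, fibreTransport_fibreEquiv, fibreTransport_fibreEquiv, ← fibreEquiv_map] at this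
  rw [Functor.map_comp, Functor.map_comp]
  exact this

/-- Tameness of `E` enters here: an equivariant bijection between fibres of `H` comes from an
isomorphism. -/
theorem exists_fibreTransport_eq (hH : IsTameInfiniteGalois H) {X : C} {Y : D}
    (b : F.obj X ≃ G.obj Y)
    (hb : ∀ σ x, b ((pi1Map u α σ).hom.app X x) = (pi1Map v β σ).hom.app Y (b x)) :
    ∃ f : u.obj X ≅ v.obj Y, fibreTransport α β f = b := by
  obtain ⟨f, hf⟩ := hH.exists_iso_map_eq (X := u.obj X) (Y := v.obj Y)
    (((fibreEquiv α X).trans b).trans (fibreEquiv β Y).symm) fun σ x => by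
      simp only [Equiv.trans_apply]
      rw [Equiv.symm_apply_eq, ← pi1Map_fibreEquiv, ← pi1Map_fibreEquiv, hb,
        Equiv.apply_symm_apply]
  refine ⟨f, Equiv.ext fun x => ?_⟩
  obtain ⟨x, rfl⟩ := (fibreEquiv α X).surjective x
  rw [fibreTransport_fibreEquiv, hf]
  exact Equiv.apply_symm_apply _ _

end Transport

/-! ### The fibre product as the category of sets over the Van Kampen quotient -/

section FibreProduct

variable {s : ℕ} {C : Type u₁} [Category.{v₁} C] {D : Type u₂} [Category.{v₂} D]
  {E : Fin s → Type u₃} [∀ j, Category.{v₃} (E j)]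
  {F : C ⥤ Type w} {G : D ⥤ Type w} {H : ∀ j, E j ⥤ Type w}
  {u : ∀ j, C ⥤ E j} {v : ∀ j, D ⥤ E j}
  (α : ∀ j, u j ⋙ H j ≅ F) (β : ∀ j, v j ⋙ H j ≅ G)

/-- The bijections between the fibres of the components of an object of the fibre product. -/
def gluingEquiv (X : CategoricalPullback (Functor.pi' u) (Functor.pi' v)) (j : Fin s) :
    F.obj X.fst ≃ G.obj X.snd :=
  fibreTransport (α j) (β j) (Pi.isoApp X.iso j)

theorem gluingEquiv_naturality {X Y : CategoricalPullback (Functor.pi' u) (Functor.pi' v)}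
    (f : X ⟶ Y) (j : Fin s) (x : F.obj X.fst) :
    gluingEquiv α β Y j (F.map f.fst x) = G.map f.snd (gluingEquiv α β X j x) :=
  fibreTransport_map (α j) (β j) (Pi.isoApp X.iso j) (Pi.isoApp Y.iso j) f.fst f.snd
    (congrFun f.w j) x

theorem gluingEquiv_smul (X : CategoricalPullback (Functor.pi' u) (Functor.pi' v)) (j : Fin s)
    (σ : Pi1 (H j)) (x : F.obj X.fst) :
    gluingEquiv α β X j (((fiberFunctor F).obj X.fst).ρ (pi1Map (u j) (α j) σ) x) =
      ((fiberFunctor G).obj X.snd).ρ (pi1Map (v j) (β j) σ) (gluingEquiv α β X j x) :=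
  fibreTransport_smul (α j) (β j) (Pi.isoApp X.iso j) σ x

variable [NeZero s]

/-- The functor from the fibre product to the sets with an action of the Van Kampen quotient. -/
def fibreProductFunctor : CategoricalPullback (Functor.pi' u) (Functor.pi' v) ⥤
    GSet.{w} (VKQuotient.{w} (fun j => pi1Map (u j) (α j)) (fun j => pi1Map (v j) (β j))) where
  obj X := gluedGSet ((fiberFunctor F).obj X.fst) ((fiberFunctor G).obj X.snd)
    (gluingEquiv α β X) (gluingEquiv_smul α β X)
  map f := gluedHom ((fiberFunctor F).map f.fst) ((fiberFunctor G).map f.snd)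
    (gluingEquiv_naturality α β f)
  map_id X := GSet.Hom.ext (funext fun x => ConcreteCategory.congr_hom (F.map_id X.fst) x)
  map_comp f g := GSet.Hom.ext (funext fun x =>
    ConcreteCategory.congr_hom (F.map_comp f.fst g.fst) x)

/-- The functor to sets with an action is compatible with the fibre functors. -/
def fibreProductFunctorForget : fibreProductFunctor α β ⋙ GSet.forget _ ≅
    CategoricalPullback.π₁ (Functor.pi' u) (Functor.pi' v) ⋙ F := Iso.refl _

theorem faithful_fibreProductFunctor [F.Faithful] [G.Faithful] :
    (fibreProductFunctor α β).Faithful where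
  map_injective {X Y f g} h := by
    have h₁ (x : F.obj X.fst) : F.map f.fst x = F.map g.fst x :=
      congrFun (congrArg GSet.Hom.toFun h) x
    refine CategoricalPullback.hom_ext (F.map_injective (ConcreteCategory.hom_ext _ _ h₁))
      (G.map_injective (ConcreteCategory.hom_ext _ _ fun y => ?_))
    obtain ⟨x, rfl⟩ := (gluingEquiv α β X 0).surjective y
    rw [← gluingEquiv_naturality, ← gluingEquiv_naturality, h₁]

/-- Both components of a map of glued sets lift, by fullness for `C` and `D`. The square over each
`E j` commutes because it does so on fibres and `H j` is faithful. -/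
theorem full_fibreProductFunctor (hF : IsTameInfiniteGalois F) (hG : IsTameInfiniteGalois G)
    [∀ j, (H j).Faithful] : (fibreProductFunctor α β).Full where
  map_surjective {X Y} k := by
    have := hF.full_fiberFunctor
    have := hG.full_fiberFunctor
    obtain ⟨f, hf⟩ := (fiberFunctor F).map_surjective (gluedHomLeft (P'' := fun j => Pi1 (H j))
      (ψ := fun j => pi1Map (u j) (α j)) (φ := fun j => pi1Map (v j) (β j))
      (S := (fiberFunctor F).obj X.fst) (T := (fiberFunctor G).obj X.snd) (b := gluingEquiv α β X)
      (S' := (fiberFunctor F).obj Y.fst) (T' := (fiberFunctor G).obj Y.snd)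
      (b' := gluingEquiv α β Y) (hb := gluingEquiv_smul α β X) (hb' := gluingEquiv_smul α β Y) k)
    obtain ⟨g, hg⟩ := (fiberFunctor G).map_surjective (gluedHomRight (P'' := fun j => Pi1 (H j))
      (ψ := fun j => pi1Map (u j) (α j)) (φ := fun j => pi1Map (v j) (β j))
      (S := (fiberFunctor F).obj X.fst) (T := (fiberFunctor G).obj X.snd) (b := gluingEquiv α β X)
      (S' := (fiberFunctor F).obj Y.fst) (T' := (fiberFunctor G).obj Y.snd)
      (b' := gluingEquiv α β Y) (hb := gluingEquiv_smul α β X) (hb' := gluingEquiv_smul α β Y) k)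
    have hf' (x : F.obj X.fst) : F.map f x = k.toFun x := congrFun (congrArg GSet.Hom.toFun hf) x
    refine ⟨⟨f, g, Pi.ext _ fun j => ?_⟩, GSet.Hom.ext (funext hf')⟩
    refine comm_of_fibreTransport_map (α j) (β j) (Pi.isoApp X.iso j) (Pi.isoApp Y.iso j) f g
      fun x => ?_
    have h := gluedHomRight_apply (P'' := fun j => Pi1 (H j))
      (ψ := fun j => pi1Map (u j) (α j)) (φ := fun j => pi1Map (v j) (β j))
      (S := (fiberFunctor F).obj X.fst) (T := (fiberFunctor G).obj X.snd) (b := gluingEquiv α β X)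
      (S' := (fiberFunctor F).obj Y.fst) (T' := (fiberFunctor G).obj Y.snd)
      (b' := gluingEquiv α β Y) (hb := gluingEquiv_smul α β X) (hb' := gluingEquiv_smul α β Y) k j x
    rw [← hf, ← hg] at h
    exact h

/-- The restrictions of `R` to the two groups are fibres of some `X` and `Y`. The edge `v j` acts as
a bijection between these fibres, equivariant for `π₁(E j)` by the relations, hence induced by an
isomorphism in `E j`. -/
theorem essSurj_fibreProductFunctor (hF : IsTameInfiniteGalois F) (hG : IsTameInfiniteGalois G)
    (hH : ∀ j, IsTameInfiniteGalois (H j)) : (fibreProductFunctor α β).EssSurj where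
  mem_essImage R := by
    obtain ⟨X, e, he⟩ := hF.exists_equiv (R.res (VKQuotient.ofLeft _ _)).ρ
      (R.res (VKQuotient.ofLeft _ _)).isOpen_setOf_eq
    obtain ⟨Y, e', he'⟩ := hG.exists_equiv (R.res (VKQuotient.ofRight _ _)).ρ
      (R.res (VKQuotient.ofRight _ _)).isOpen_setOf_eq
    have hb := edgeEquiv_smul (S := (fiberFunctor F).obj X) (T := (fiberFunctor G).obj Y)
      (P'' := fun j => Pi1 (H j)) (ψ := fun j => pi1Map (u j) (α j))
      (φ := fun j => pi1Map (v j) (β j)) (R := R) (e := e) (e' := e') he he'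
    choose f hf using fun j => exists_fibreTransport_eq (α j) (β j) (hH j) _ (hb j)
    let Z : CategoricalPullback (Functor.pi' u) (Functor.pi' v) := ⟨X, Y, Pi.isoMk f⟩
    exact ⟨Z, nonempty_gluedIso (S := (fiberFunctor F).obj X) (T := (fiberFunctor G).obj Y)
      (P'' := fun j => Pi1 (H j)) (ψ := fun j => pi1Map (u j) (α j))
      (φ := fun j => pi1Map (v j) (β j)) (R := R) (e := e) (e' := e')
      (gluingEquiv α β Z) (gluingEquiv_smul α β Z) he he' hf⟩

end FibreProduct

end InfGalois

theorem proposition2p10 {s : ℕ} [NeZero s]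
    {C : Type u₁} [Category.{v₁} C] {D : Type u₂} [Category.{v₂} D]
    {E : Fin s → Type u₃} [∀ j, Category.{v₃} (E j)]
    (F : C ⥤ Type w) (G : D ⥤ Type w) (H : ∀ j, E j ⥤ Type w)
    (hF : InfGalois.IsTameInfiniteGalois F) (hG : InfGalois.IsTameInfiniteGalois G)
    (hH : ∀ j, InfGalois.IsTameInfiniteGalois (H j))
    (u : ∀ j, C ⥤ E j) (v : ∀ j, D ⥤ E j)
    (α : ∀ j, u j ⋙ H j ≅ F) (β : ∀ j, v j ⋙ H j ≅ G) :
    InfGalois.IsTameInfiniteGalois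
        (CategoricalPullback.π₁ (Functor.pi' u) (Functor.pi' v) ⋙ F) ∧
      Nonempty
        (InfGalois.Pi1 (CategoricalPullback.π₁ (Functor.pi' u) (Functor.pi' v) ⋙ F) ≃ₜ*
          InfGalois.VK.{w} (fun j => InfGalois.pi1Map (u j) (α j))
            (fun j => InfGalois.pi1Map (v j) (β j))) := by
  have := hF.faithful
  have := hG.faithful
  have := fun j => (hH j).faithful
  -- Smallness of the two groups passes to the Noohi coproducts and to `VKQuotient`, which gives its
  -- category of sets a small family of generators.
  have := hF.small_pi1
  have := hG.small_pi1
  have := InfGalois.faithful_fibreProductFunctor α β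
  have := InfGalois.full_fibreProductFunctor α β hF hG
  have := InfGalois.essSurj_fibreProductFunctor α β hF hG hH
  have : (InfGalois.fibreProductFunctor α β).IsEquivalence := {}
  let e := (InfGalois.fibreProductFunctor α β).asEquivalence
  exact ⟨InfGalois.GSet.isTameInfiniteGalois_forget.of_equivalence e
      (InfGalois.fibreProductFunctorForget α β),
    InfGalois.nonempty_pi1_equiv e (InfGalois.fibreProductFunctorForget α β)⟩
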